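/- **Networks.** Let $\Xi$ be a complete separable metric space. A network is a connected, locally finite simple graph $G=(V,E)$ together with a capacity $b_v\in\mathbb N$ on each vertex $v$, a capacity $c_{uv}=c_{vu}\in\mathbb N$ on each edge $uv$, and possibly further marks in $\Xi$ on the vertices and on the directed edges $\overrightarrow{uv}$. Let $\mathcal G_*$ (resp. $\mathcal G_{**}$) be the space of isomorphism classes of networks with one distinguished vertex, the root (resp. with an ordered pair of distinguished vertices). Both carry the local topology, given by the distance $1/(1+\delta)$, where $\delta$ is the supremum of all $d\ge 0$ such that the balls of radius $\lfloor d\rfloor$ around the distinguished vertices are isomorphic by an isomorphism which respects the distinguished vertices and the capacities and for which corresponding marks in $\Xi$ have distance less than $1/d$. A Borel probability measure $\rho$ on $\mathcal G_*$ is unimodular if $$\int\sum_{v\in V}f(G,r,v)\,d\rho([G,r])=\int\sum_{v\in V}f(G,v,r)\,d\rho([G,r])\qquad\text{for all Borel } f:\mathcal G_{**}\to[0,\infty].$$ **Belief propagation.** Let $\widetilde{\mathcal P}$ be the set of probability distributions on $\mathbb N$ with bounded support whose support is an interval containing $0$. For $\lambda\ge 0$ (with $0^0=1$), a network $G$ with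 set of directed edges $\overrightarrow E$, and $\mathbf m=(m_{\overrightarrow e})_{\overrightarrow e\in\overrightarrow E}\in\widetilde{\mathcal P}^{\overrightarrow E}$, let, for $\overrightarrow{vu}\in\overrightarrow E$ and $x\in\mathbb N$, $$\mathcal R^{(\lambda)}_{\overrightarrow{vu}}[\mathbf m](x)=\frac{\lambda^x\,\mathbf 1(x\le c_{vu})\,\sum_{|\mathbf y|\le b_v-x}\ \prod_{w\sim v,\,w\ne u}m_{\overrightarrow{wv}}(y_w)}{\sum_{t\le c_{vu}}\lambda^t\,\sum_{|\mathbf y|\le b_v-t}\ \prod_{w\sim v,\,w\ne u}m_{\overrightarrow{wv}}(y_w)},$$ where $\mathbf y$ ranges over the families $(y_w)_{w\sim v,\,w\neq u}$ of natural numbers, $|\mathbf y|=\sum_w y_w$, and a sum over $|\mathbf y|\le b_v-x$ is empty if $x>b_v$. **Proposition.** Let $\rho$ be a unimodular Borel probability measure on $\mathcal G_*$ such that the expectation $\overline b(\rho)=\int b_r\,d\rho([G,r])$ of the capacity of the root is finite. Then for every $\lambda\ge 0$, for $\rho$-almost every $[G,r]$, the fixed point equation $\mathbf m=\mathcal R^{(\lambda)}[\mathbf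 m]$, that is, $m_{\overrightarrow e}=\mathcal R^{(\lambda)}_{\overrightarrow e}[\mathbf m]$ for all $\overrightarrow e\in\overrightarrow E$, has exactly one solution $\mathbf m\in\widetilde{\mathcal P}^{\overrightarrow E}$. -/

import Mathlib

open scoped ENNReal NNReal

universe u

/-- A connected, locally finite simple graph with an integer capacity on each vertex, an integer
capacity on each undirected edge, and further marks in `Ξ` on vertices and on directed edges: a
network with mark space `ℕ × Ξ`, where the `ℕ`-component of the mark of a directed edge does not
depend on its orientation. Such a graph is countable, so vertex sets in `Type` suffice. -/
structure Network (Ξ : Type u) where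
  V : Type
  graph : SimpleGraph V
  connected : graph.Connected
  locallyFinite : ∀ v, (graph.neighborSet v).Finite
  vertexCap : V → ℕ
  edgeCap : graph.edgeSet → ℕ
  vertexMark : V → Ξ
  dartMark : graph.Dart → Ξ

/-- A network with `k` distinguished vertices, in order. -/
structure RootedNetwork (Ξ : Type u) (k : ℕ) extends Network Ξ where
  root : Fin k → V

namespace Network

variable {Ξ : Type u} (N : Network Ξ)

/-- The capacity of the undirected edge underlying a directed edge. -/
def cap (e : N.graph.Dart) : ℕ := N.edgeCap ⟨e.edge, e.edge_mem⟩

/-- `N` with the ordered pair of distinguished vertices `(r, s)`. -/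
def birootAt (r s : N.V) : RootedNetwork Ξ 2 := ⟨N, ![r, s]⟩

/-! ### Belief propagation -/

/-- For a directed edge `e` from `v` to `u`, the directed edges from `w` to `v` with
`w ≠ u`. -/
def Inputs (e : N.graph.Dart) : Type := {d : N.graph.Dart // d.snd = e.fst ∧ d.fst ≠ e.snd}

theorem finite_inputs (e : N.graph.Dart) : Finite (N.Inputs e) := by
  have := (N.locallyFinite e.fst).to_subtype
  refine Finite.of_injective
    (fun d : N.Inputs e => (⟨d.1.fst, by
      have h := d.1.adj.symm
      rw [d.2.1] at h
      exact h⟩ : N.graph.neighborSet e.fst)) ?_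
  intro d d' h
  have h1 : d.1.fst = d'.1.fst := congrArg Subtype.val h
  apply Subtype.ext
  apply SimpleGraph.Dart.ext
  exact Prod.ext h1 (d.2.1.trans d'.2.1.symm)

noncomputable instance (e : N.graph.Dart) : Fintype (N.Inputs e) :=
  have := N.finite_inputs e
  Fintype.ofFinite _

open Classical in
/-- For `e` directed from `v` to `u`: the sum of `∏ d, m d (y d)` over all families `y` of
natural numbers indexed by the inputs of `e` such that `|y| ≤ b_v - x` in `ℤ` (empty if `x > b_v`).
Such families have all entries at most `b_v`. -/
noncomputable def inputSum (m : N.graph.Dart → ℕ → ℝ) (e : N.graph.Dart) (x : ℕ) : ℝ :=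
  ∑ y ∈ (Fintype.piFinset fun _ : N.Inputs e => Finset.range (N.vertexCap e.fst + 1)) with
    (∑ d, y d) + x ≤ N.vertexCap e.fst, ∏ d, m d.1 (y d)

/-- The belief propagation update, at temperature parameter `lam`, of the message on `e`. -/
noncomputable def bpUpdate (lam : ℝ) (m : N.graph.Dart → ℕ → ℝ) (e : N.graph.Dart) (x : ℕ) : ℝ :=
  (if x ≤ N.cap e then lam ^ x * N.inputSum m e x else 0) /
    ∑ t ∈ Finset.range (N.cap e + 1), lam ^ t * N.inputSum m e t

end Network

/-- Probability distributions on `ℕ` with bounded support whose support is an interval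
containing `0`. -/
def IsMessage (p : ℕ → ℝ) : Prop :=
  (∀ i, p i ∈ Set.Icc (0 : ℝ) 1) ∧ HasSum p 1 ∧ (∃ k, ∀ i, k < i → p i = 0) ∧
    (Function.support p).OrdConnected ∧ 0 ∈ Function.support p

/-- `m` is a family of messages, one for each directed edge, which is a fixed point of the
belief propagation updates. -/
def Network.IsBPFixedPoint {Ξ : Type u} (N : Network Ξ) (lam : ℝ)
    (m : N.graph.Dart → ℕ → ℝ) : Prop :=
  (∀ e, IsMessage (m e)) ∧ m = N.bpUpdate lam m

namespace RootedNetwork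

variable {Ξ : Type u} {k : ℕ}

/-! ### Isomorphism classes and the local topology -/

/-- Isomorphism of networks with distinguished vertices. -/
def Isom (A B : RootedNetwork Ξ k) : Prop :=
  ∃ φ : A.graph ≃g B.graph,
    (∀ i, φ (A.root i) = B.root i) ∧
    (∀ v, B.vertexCap (φ v) = A.vertexCap v) ∧
    (∀ v, B.vertexMark (φ v) = A.vertexMark v) ∧
    (∀ e : A.graph.Dart, B.cap (φ.toHom.mapDart e) = A.cap e) ∧
    (∀ e : A.graph.Dart, B.dartMark (φ.toHom.mapDart e) = A.dartMark e)

theorem Isom.refl (A : RootedNetwork Ξ k) : A.Isom A :=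
  ⟨SimpleGraph.Iso.refl, fun _ => rfl, fun _ => rfl, fun _ => rfl, fun _ => rfl, fun _ => rfl⟩

theorem Isom.trans {A B C : RootedNetwork Ξ k} : A.Isom B → B.Isom C → A.Isom C := by
  rintro ⟨φ, h1, h2, h3, h4, h5⟩ ⟨ψ, g1, g2, g3, g4, g5⟩
  refine ⟨φ.trans ψ, fun i => ?_, fun v => ?_, fun v => ?_, fun e => ?_, fun e => ?_⟩
  · exact (congrArg ψ (h1 i)).trans (g1 i)
  · exact (g2 (φ v)).trans (h2 v)
  · exact (g3 (φ v)).trans (h3 v)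
  · exact (g4 (φ.toHom.mapDart e)).trans (h4 e)
  · exact (g5 (φ.toHom.mapDart e)).trans (h5 e)

theorem Isom.symm {A B : RootedNetwork Ξ k} : A.Isom B → B.Isom A := by
  rintro ⟨φ, h1, h2, h3, h4, h5⟩
  have key : ∀ e : B.graph.Dart, φ.toHom.mapDart (φ.symm.toHom.mapDart e) = e := by
    intro e
    apply SimpleGraph.Dart.ext
    exact Prod.ext (φ.apply_symm_apply _) (φ.apply_symm_apply _)
  refine ⟨φ.symm, fun i => ?_, fun v => ?_, fun v => ?_, fun e => ?_, fun e => ?_⟩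
  · rw [← h1 i]; exact φ.symm_apply_apply _
  · rw [← h2]; exact congrArg B.vertexCap (φ.apply_symm_apply v)
  · rw [← h3]; exact congrArg B.vertexMark (φ.apply_symm_apply v)
  · rw [← h4, key]
  · rw [← h5, key]

instance isomSetoid (Ξ : Type u) (k : ℕ) : Setoid (RootedNetwork Ξ k) where
  r := Isom
  iseqv := ⟨Isom.refl, Isom.symm, Isom.trans⟩

/-- The vertices at graph distance at most `n` from one of the distinguished vertices. -/
def ball (A : RootedNetwork Ξ k) (n : ℕ) : Set A.V :=
  {v | ∃ i, A.graph.dist (A.root i) v ≤ n}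

theorem root_mem_ball (A : RootedNetwork Ξ k) (n : ℕ) (i : Fin k) : A.root i ∈ A.ball n :=
  ⟨i, by simp⟩

/-- There is an isomorphism between the balls of radius `⌊d⌋` around the distinguished vertices
(as induced subgraphs), respecting the distinguished vertices, for which corresponding capacities
agree and corresponding marks in `Ξ` have distance less than `1 / d`. -/
def BallIsom [MetricSpace Ξ] (d : ℝ≥0) (A B : RootedNetwork Ξ k) : Prop :=
  ∃ φ : A.ball ⌊d⌋₊ ≃ B.ball ⌊d⌋₊,
    (∀ i, φ ⟨A.root i, A.root_mem_ball _ i⟩ = ⟨B.root i, B.root_mem_ball _ i⟩) ∧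
    (∀ x y : A.ball ⌊d⌋₊, B.graph.Adj (φ x) (φ y) ↔ A.graph.Adj x y) ∧
    (∀ x : A.ball ⌊d⌋₊, B.vertexCap (φ x) = A.vertexCap x) ∧
    (∀ x : A.ball ⌊d⌋₊, edist (A.vertexMark x) (B.vertexMark (φ x)) < (d : ℝ≥0∞)⁻¹) ∧
    (∀ (x y : A.ball ⌊d⌋₊) (h : A.graph.Adj x y) (h' : B.graph.Adj (φ x) (φ y)),
      B.cap ⟨(↑(φ x), ↑(φ y)), h'⟩ = A.cap ⟨(↑x, ↑y), h⟩ ∧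
      edist (A.dartMark ⟨(↑x, ↑y), h⟩) (B.dartMark ⟨(↑(φ x), ↑(φ y)), h'⟩) < (d : ℝ≥0∞)⁻¹)

end RootedNetwork

/-- The space of isomorphism classes of connected locally finite networks with `k` distinguished
vertices. -/
def NetworkSpace (Ξ : Type u) (k : ℕ) : Type (max 1 u) :=
  Quotient (RootedNetwork.isomSetoid Ξ k)

/-- The isomorphism class of a network with distinguished vertices. -/
def RootedNetwork.cls {Ξ : Type u} {k : ℕ} (A : RootedNetwork Ξ k) : NetworkSpace Ξ k :=
  Quotient.mk _ A

namespace NetworkSpace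

variable {Ξ : Type u} {k : ℕ}

/-- The distance `1 / (1 + δ)`, where `δ` is the supremum of all `d ≥ 0` for which the balls of
radius `⌊d⌋` are isomorphic with marks closer than `1 / d`. -/
noncomputable def localDist [MetricSpace Ξ] (g h : NetworkSpace Ξ k) : ℝ≥0∞ :=
  (1 + ⨆ (d : ℝ≥0) (_ : ∃ A B : RootedNetwork Ξ k, A.cls = g ∧ B.cls = h ∧ A.BallIsom d B),
    (d : ℝ≥0∞))⁻¹

/-- The topology generated by the open balls of `localDist`. -/
instance [MetricSpace Ξ] : TopologicalSpace (NetworkSpace Ξ k) :=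
  TopologicalSpace.generateFrom {U | ∃ (g : NetworkSpace Ξ k) (ε : ℝ≥0∞), U = {h | localDist g h < ε}}

instance [MetricSpace Ξ] : MeasurableSpace (NetworkSpace Ξ k) := borel _

instance [MetricSpace Ξ] : BorelSpace (NetworkSpace Ξ k) := ⟨rfl⟩

theorem birootAt_cls_congr {A B : RootedNetwork Ξ 1} (φ : A.graph ≃g B.graph)
    (h2 : ∀ v, B.vertexCap (φ v) = A.vertexCap v)
    (h3 : ∀ v, B.vertexMark (φ v) = A.vertexMark v)
    (h4 : ∀ e : A.graph.Dart, B.cap (φ.toHom.mapDart e) = A.cap e)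
    (h5 : ∀ e : A.graph.Dart, B.dartMark (φ.toHom.mapDart e) = A.dartMark e) (r s : A.V) :
    (A.birootAt r s).cls = (B.birootAt (φ r) (φ s)).cls :=
  Quotient.sound ⟨φ, Fin.forall_fin_two.2 ⟨rfl, rfl⟩, h2, h3, h4, h5⟩

/-- The sum over all vertices `v` of `f (G, r, v)`, as a function of the class of `(G, r)`. -/
noncomputable def massOut (f : NetworkSpace Ξ 2 → ℝ≥0∞) : NetworkSpace Ξ 1 → ℝ≥0∞ :=
  Quotient.lift (fun A : RootedNetwork Ξ 1 => ∑' v : A.V, f (A.birootAt (A.root 0) v).cls) (by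
    rintro A B ⟨φ, h1, h2, h3, h4, h5⟩
    rw [← φ.toEquiv.tsum_eq]
    refine tsum_congr fun v => ?_
    rw [birootAt_cls_congr φ h2 h3 h4 h5, h1]
    rfl)

/-- The sum over all vertices `v` of `f (G, v, r)`, as a function of the class of `(G, r)`. -/
noncomputable def massIn (f : NetworkSpace Ξ 2 → ℝ≥0∞) : NetworkSpace Ξ 1 → ℝ≥0∞ :=
  Quotient.lift (fun A : RootedNetwork Ξ 1 => ∑' v : A.V, f (A.birootAt v (A.root 0)).cls) (by
    rintro A B ⟨φ, h1, h2, h3, h4, h5⟩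
    rw [← φ.toEquiv.tsum_eq]
    refine tsum_congr fun v => ?_
    rw [birootAt_cls_congr φ h2 h3 h4 h5, h1]
    rfl)

/-- The capacity of the root. -/
def rootCap : NetworkSpace Ξ 1 → ℕ :=
  Quotient.lift (fun A : RootedNetwork Ξ 1 => A.vertexCap (A.root 0)) (by
    rintro A B ⟨φ, h1, h2, -⟩
    rw [← h1, h2])

end NetworkSpace

/-- The mass-transport principle. -/
def IsUnimodular {Ξ : Type u} [MetricSpace Ξ] (ρ : MeasureTheory.Measure (NetworkSpace Ξ 1)) :
    Prop :=
  ∀ f : NetworkSpace Ξ 2 → ℝ≥0∞, Measurable f →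
    ∫⁻ g, NetworkSpace.massOut f g ∂ρ = ∫⁻ g, NetworkSpace.massIn f g ∂ρ

/-!
The messages of belief propagation only matter up to scaling, so they are normalised to take the
value `1` at `0`. They are compared in the upshifted likelihood ratio order `UpLR`, which is
compatible with convolution (`PowerSeries.UpLE.mul`). An update convolves the incoming messages,
sums, and reflects the index `x` to `b_v - x`, so it is antitone for this order
(`Network.weightUpdate_antitone`). Started at the point mass at `0`, which is the least element, the
even iterates increase to a limit `m⁻`, the odd iterates decrease to a limit `m⁺`, the update
exchanges `m⁻` and `m⁺`, and every fixed point lies between them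
(`Network.upLR_weightIter_fixed`). So there is exactly one fixed point as soon as `m⁻ = m⁺`
(`Network.existsUnique_isBPFixedPoint`).

To prove `m⁻ = m⁺` almost surely, let the load of a vertex under a family of messages be the mean
of the total of independent incoming messages conditioned not to exceed the capacity. It is monotone
in the messages, and equality of the loads at `v` under `m⁻` and `m⁺` forces the two families of
messages into `v` to agree as far as the updates out of `v` depend on them
(`Network.weightLow_eq_weightHigh`). The load of `v` is a sum over the edges at `v`
(`Network.sum_edgeLoad`). Since `m⁺` is the update of `m⁻` and conversely, the load of the edge `vu`
seen from `v` under `m⁻` and its load seen from `u` under `m⁺` are both given by the same expression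
in `m⁻` from `u` to `v` and `m⁺` from `v` to `u`. Letting `v` send this amount to `u`, each vertex
sends in total its load under `m⁻` and receives its load under `m⁺`. By the mass-transport principle
the two loads of the root have the same expectation, which is at most that of the capacity, hence
finite; being ordered, they agree almost surely at the root, and by a second mass transport at every
vertex (`RootedNetwork.ae_forall_inFlow_le_outFlow`).

The functions which are transported are pointwise limits of functions depending only on the graph
and the capacities in a ball of fixed radius. The latter are locally constant in the local topology
(`NetworkSpace.measurable_of_isLocal`), so everything is Borel measurable.
-/

/-! ### The upshifted likelihood ratio order -/

/-- The upshifted likelihood ratio order on sequences of weights: every shift to the left of `p` is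
below `q` in the likelihood ratio order. It is not reflexive: `UpLR p p` says that `p` is
log-concave. -/
def UpLR (p q : ℕ → ℝ) : Prop :=
  ∀ i k l, p (i + k + l) * q i ≤ p (i + l) * q (i + k)

/-- If `φ` and `γ` are functions on `ℤ` such that `φ x ≤ φ y` whenever `y` is at most as far from
`σ / 2` as `x ≥ σ / 2`, and likewise for `γ` and `τ / 2`, then their convolution has the same
property with respect to `(σ + τ) / 2`. -/
theorem tsum_mul_sub_le_of_centered {σ τ u w : ℤ} {φ γ : ℤ → ℝ}
    (hγf : γ.support.Finite) (hφ : ∀ x y, σ - x ≤ y → y ≤ x → φ x ≤ φ y)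
    (hγ : ∀ x y, τ - x ≤ y → y ≤ x → γ x ≤ γ y) (h1 : σ + τ - u ≤ w) (h2 : w ≤ u) :
    ∑' p, φ p * γ (u - p) ≤ ∑' p, φ p * γ (w - p) := by
  have S : ∀ (h : ℤ → ℝ) (v : ℤ), Summable fun p => h p * γ (v - p) := by
    intro h v
    apply summable_of_hasFiniteSupport
    refine (hγf.preimage (f := fun p => v - p) (fun a _ b _ hab => by simpa using hab)).subset ?_
    intro p hp
    exact right_ne_zero_of_mul hp
  -- the part of `φ` which is symmetric about `σ / 2`; the rest is nonnegative and lives to the left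
  set ψ : ℤ → ℝ := fun p => φ (max p (σ - p)) with hψ
  have hψ' : ∀ x y, σ - x ≤ y → y ≤ x → ψ x ≤ ψ y := by
    intro x y hx hy
    apply hφ <;> omega
  have hψs : ∀ x, ψ (σ - x) = ψ x := by
    intro x
    simp only [hψ]
    congr 1
    omega
  have hrest : ∑' p, (φ p - ψ p) * γ (u - p) ≤ ∑' p, (φ p - ψ p) * γ (w - p) := by
    refine Summable.tsum_le_tsum (fun p => ?_) (S _ _) (S _ _)
    rcases le_or_gt (σ - p) p with hp | hp
    · have : φ p - ψ p = 0 := by simp only [hψ, max_eq_left hp, sub_self]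
      rw [this, zero_mul, zero_mul]
    · apply mul_le_mul_of_nonneg_left
      · apply hγ <;> omega
      · rw [sub_nonneg]
        apply hφ <;> omega
  have key : ∀ v, ∑' p, ψ p * γ (v - p) = ∑' q, γ q * ψ (v - q) := by
    intro v
    rw [← (Equiv.subLeft v).tsum_eq]
    refine tsum_congr fun q => ?_
    simp only [Equiv.subLeft_apply, sub_sub_cancel]
    ring
  have S' : ∀ (h : ℤ → ℝ), Summable fun q => γ q * h q := by
    intro h
    apply summable_of_hasFiniteSupport
    exact hγf.subset fun p hp => left_ne_zero_of_mul hp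
  have S'' : ∀ (h : ℤ → ℝ), Summable fun q => γ (u + w - σ - q) * h q := by
    intro h
    have := S h (u + w - σ)
    simpa only [mul_comm] using this
  have hsym : 0 ≤ ∑' q, γ q * (ψ (w - q) - ψ (u - q)) := by
    -- the second factor is odd under the reflection `q ↦ u + w - σ - q`, and `γ` is larger on the
    -- side where it is nonnegative
    have hrefl : ∑' q, γ q * (ψ (w - q) - ψ (u - q)) =
        - ∑' q, γ (u + w - σ - q) * (ψ (w - q) - ψ (u - q)) := by
      rw [← tsum_neg, ← (Equiv.subLeft (u + w - σ)).tsum_eq]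
      refine tsum_congr fun q => ?_
      simp only [Equiv.subLeft_apply]
      rw [show w - (u + w - σ - q) = σ - (u - q) by ring, hψs,
        show u - (u + w - σ - q) = σ - (w - q) by ring, hψs]
      ring
    have hdiff : 0 ≤ ∑' q, (γ q * (ψ (w - q) - ψ (u - q)) -
        γ (u + w - σ - q) * (ψ (w - q) - ψ (u - q))) := by
      refine tsum_nonneg fun q => ?_
      rw [← sub_mul]
      rcases le_total q (u + w - σ - q) with hq | hq
      · apply mul_nonneg <;> rw [sub_nonneg]
        · apply hγ <;> omega
        · apply hψ' <;> omega
      · apply mul_nonneg_of_nonpos_of_nonpos <;> rw [sub_nonpos]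
        · apply hγ <;> omega
        · rw [← hψs (u - q), ← hψs (w - q)]
          apply hψ' <;> omega
    rw [Summable.tsum_sub (S' _) (S'' _)] at hdiff
    linarith
  have hsym' : ∑' p, ψ p * γ (u - p) ≤ ∑' p, ψ p * γ (w - p) := by
    rw [key, key, ← sub_nonneg, ← Summable.tsum_sub (S' _) (S' _)]
    simpa only [mul_sub] using hsym
  have hsplit : ∀ v, ∑' p, φ p * γ (v - p) =
      ∑' p, ψ p * γ (v - p) + ∑' p, (φ p - ψ p) * γ (v - p) := by
    intro v
    rw [← Summable.tsum_add (S _ _) (S _ _)]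
    refine tsum_congr fun p => ?_
    ring
  rw [hsplit, hsplit]
  exact add_le_add hsym' hrest

namespace PowerSeries

/-- The coefficients of a power series, extended by zero to negative indices. -/
noncomputable def intCoeff (P : PowerSeries ℝ) (n : ℤ) : ℝ :=
  if 0 ≤ n then coeff n.toNat P else 0

theorem intCoeff_natCast (P : PowerSeries ℝ) (n : ℕ) : P.intCoeff n = coeff n P := by
  simp [intCoeff]

theorem intCoeff_of_neg (P : PowerSeries ℝ) {n : ℤ} (h : n < 0) : P.intCoeff n = 0 := by
  simp [intCoeff, h]

theorem intCoeff_nonneg {P : PowerSeries ℝ} (hP : ∀ n, 0 ≤ coeff n P) (n : ℤ) :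
    0 ≤ P.intCoeff n := by
  unfold intCoeff
  split_ifs
  · exact hP _
  · exact le_rfl

theorem support_intCoeff_mul_subset (P Q : PowerSeries ℝ) (u : ℤ) :
    (fun p => P.intCoeff p * Q.intCoeff (u - p)).support ⊆ Set.Icc 0 u := by
  intro p hp
  rw [Function.mem_support] at hp
  constructor
  · by_contra! h
    exact hp (by rw [P.intCoeff_of_neg h, zero_mul])
  · by_contra! h
    exact hp (by rw [Q.intCoeff_of_neg (by omega), mul_zero])

theorem intCoeff_mul (P Q : PowerSeries ℝ) (u : ℤ) :
    (P * Q).intCoeff u = ∑' p, P.intCoeff p * Q.intCoeff (u - p) := by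
  rcases lt_or_ge u 0 with hu | hu
  · rw [intCoeff_of_neg _ hu, eq_comm]
    convert tsum_zero with p
    have := support_intCoeff_mul_subset P Q u
    rw [Set.Icc_eq_empty (by omega), Set.subset_empty_iff, Function.support_eq_empty_iff] at this
    exact congrFun this p
  · lift u to ℕ using hu
    rw [intCoeff_natCast, coeff_mul, Finset.Nat.sum_antidiagonal_eq_sum_range_succ
      (fun i j => coeff i P * coeff j Q),
      tsum_eq_sum (s := (Finset.range u.succ).map Nat.castEmbedding), Finset.sum_map]
    · refine Finset.sum_congr rfl fun i hi => ?_
      rw [Finset.mem_range] at hi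
      rw [Nat.castEmbedding_apply, ← Nat.cast_sub (by omega), intCoeff_natCast, intCoeff_natCast]
    · intro p hp
      by_contra h
      have := support_intCoeff_mul_subset P Q u h
      apply hp
      rw [Finset.mem_map]
      obtain ⟨h0, h1⟩ := this
      lift p to ℕ using h0
      exact ⟨p, by rw [Finset.mem_range]; omega, rfl⟩

/-- The upshifted likelihood ratio order between two power series with nonnegative coefficients. -/
def UpLE (P Q : PowerSeries ℝ) : Prop :=
  (∀ n, 0 ≤ coeff n P) ∧ (∀ n, 0 ≤ coeff n Q) ∧ UpLR (fun n => coeff n P) (fun n => coeff n Q)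

theorem UpLE.intCoeff {P Q : PowerSeries ℝ} (h : UpLE P Q) (s x y : ℤ) (h1 : s - x ≤ y)
    (h2 : y ≤ x) :
    P.intCoeff x * Q.intCoeff (s - x) ≤ P.intCoeff y * Q.intCoeff (s - y) := by
  rcases lt_or_ge (s - x) 0 with hs | hs
  · rw [Q.intCoeff_of_neg hs, mul_zero]
    exact mul_nonneg (intCoeff_nonneg h.1 _) (intCoeff_nonneg h.2.1 _)
  · obtain ⟨i, hi⟩ := Int.eq_ofNat_of_zero_le hs
    obtain ⟨k, hk⟩ := Int.eq_ofNat_of_zero_le (sub_nonneg.2 h2)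
    obtain ⟨l, hl⟩ := Int.eq_ofNat_of_zero_le (sub_nonneg.2 h1)
    have := h.2.2 i k l
    simp only [← intCoeff_natCast] at this
    rw [hi, show x = ((i + k + l : ℕ) : ℤ) by omega, show s - y = ((i + k : ℕ) : ℤ) by omega,
      show y = ((i + l : ℕ) : ℤ) by omega]
    exact this

/-- The upshifted likelihood ratio order is compatible with convolution. -/
theorem UpLE.mul {P₁ Q₁ P₂ Q₂ : PowerSeries ℝ} (h₁ : UpLE P₁ Q₁) (h₂ : UpLE P₂ Q₂) :
    UpLE (P₁ * P₂) (Q₁ * Q₂) := by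
  have hnn : ∀ {P Q : PowerSeries ℝ}, (∀ n, 0 ≤ coeff n P) → (∀ n, 0 ≤ coeff n Q) →
      ∀ n, 0 ≤ coeff n (P * Q) := by
    intro P Q hP hQ n
    rw [coeff_mul]
    exact Finset.sum_nonneg fun x _ => mul_nonneg (hP _) (hQ _)
  refine ⟨hnn h₁.1 h₂.1, hnn h₁.2.1 h₂.2.1, ?_⟩
  -- the product of two coefficients, sorted by the sum `s` of the two indices of the first factors
  have hprod : ∀ a b : ℤ,
      (Summable fun s : ℤ => ∑' p, (P₁.intCoeff p * Q₁.intCoeff (s - p)) *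
        (P₂.intCoeff (a - p) * Q₂.intCoeff (a + b - s - (a - p)))) ∧
      (P₁ * P₂).intCoeff a * (Q₁ * Q₂).intCoeff b =
      ∑' s : ℤ, ∑' p, (P₁.intCoeff p * Q₁.intCoeff (s - p)) *
        (P₂.intCoeff (a - p) * Q₂.intCoeff (a + b - s - (a - p))) := by
    intro a b
    set F : ℤ × ℤ → ℝ := fun x => (P₁.intCoeff x.1 * P₂.intCoeff (a - x.1)) *
      (Q₁.intCoeff x.2 * Q₂.intCoeff (b - x.2)) with hF
    have hf1 : (fun p => P₁.intCoeff p * P₂.intCoeff (a - p)).support.Finite :=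
      (Set.finite_Icc _ _).subset (support_intCoeff_mul_subset _ _ _)
    have hf2 : (fun p => Q₁.intCoeff p * Q₂.intCoeff (b - p)).support.Finite :=
      (Set.finite_Icc _ _).subset (support_intCoeff_mul_subset _ _ _)
    have hsum : Summable F := by
      apply summable_of_hasFiniteSupport
      refine (hf1.prod hf2).subset ?_
      intro x hx
      exact ⟨left_ne_zero_of_mul hx, right_ne_zero_of_mul hx⟩
    let e : ℤ × ℤ ≃ ℤ × ℤ :=
      { toFun := fun x => (x.2, x.1 - x.2)
        invFun := fun x => (x.1 + x.2, x.1)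
        left_inv := fun x => by simp
        right_inv := fun x => by simp }
    have hsum' : Summable (F ∘ e) := e.summable_iff.2 hsum
    have hFe : ∀ s p : ℤ, (F ∘ e) (s, p) = (P₁.intCoeff p * Q₁.intCoeff (s - p)) *
        (P₂.intCoeff (a - p) * Q₂.intCoeff (a + b - s - (a - p))) := by
      intro s p
      simp only [hF, e, Function.comp, Equiv.coe_fn_mk]
      rw [show a + b - s - (a - p) = b - (s - p) by ring]
      ring
    constructor
    · have := hsum'.prod
      simpa only [hFe] using this
    · rw [intCoeff_mul, intCoeff_mul, Summable.tsum_mul_tsum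
        (summable_of_hasFiniteSupport hf1) (summable_of_hasFiniteSupport hf2) hsum]
      change ∑' x, F x = _
      rw [← e.tsum_eq]
      change ∑' x, (F ∘ e) x = _
      rw [hsum'.tsum_prod]
      simp only [hFe]
  intro i k l
  simp only [← intCoeff_natCast]
  obtain ⟨s1, e1⟩ := hprod ((i + k + l : ℕ) : ℤ) (i : ℕ)
  obtain ⟨s2, e2⟩ := hprod ((i + l : ℕ) : ℤ) ((i + k : ℕ) : ℤ)
  rw [e1, e2]
  refine Summable.tsum_le_tsum (fun s => ?_) s1 s2
  have hST : ((i + k + l : ℕ) : ℤ) + (i : ℕ) = ((i + l : ℕ) : ℤ) + ((i + k : ℕ) : ℤ) := by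
    push_cast; ring
  rw [hST]
  set T := ((i + l : ℕ) : ℤ) + ((i + k : ℕ) : ℤ) - s with hT
  refine tsum_mul_sub_le_of_centered (σ := s) (τ := T)
    (φ := fun p => P₁.intCoeff p * Q₁.intCoeff (s - p))
    (γ := fun q => P₂.intCoeff q * Q₂.intCoeff (T - q)) ?_ (h₁.intCoeff s) (h₂.intCoeff T)
    (by push_cast at *; omega) (by push_cast; omega)
  exact (Set.finite_Icc _ _).subset (support_intCoeff_mul_subset _ _ _)

theorem UpLE.one : UpLE 1 1 := by
  have h : ∀ n, 0 ≤ coeff n (1 : PowerSeries ℝ) := by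
    intro n
    rw [coeff_one]
    split_ifs <;> norm_num
  refine ⟨h, h, fun i k l => ?_⟩
  simp only [coeff_one]
  split_ifs <;> first | omega | norm_num

theorem UpLE.prod {ι : Type*} (s : Finset ι) {P Q : ι → PowerSeries ℝ}
    (h : ∀ i ∈ s, UpLE (P i) (Q i)) : UpLE (∏ i ∈ s, P i) (∏ i ∈ s, Q i) := by
  classical
  induction s using Finset.induction_on with
  | empty => simpa using UpLE.one
  | insert a s ha ih =>
    rw [Finset.prod_insert ha, Finset.prod_insert ha]
    exact (h a (Finset.mem_insert_self a s)).mul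
      (ih fun i hi => h i (Finset.mem_insert_of_mem hi))

/-- The power series `1 / (1 - X)`. -/
noncomputable def geom : PowerSeries ℝ := mk fun _ => 1

theorem UpLE.geom : UpLE geom geom :=
  ⟨fun n => by simp [PowerSeries.geom], fun n => by simp [PowerSeries.geom],
    fun i k l => by simp [PowerSeries.geom]⟩

theorem coeff_mul_geom (P : PowerSeries ℝ) (n : ℕ) :
    coeff n (P * geom) = ∑ i ∈ Finset.range (n + 1), coeff i P := by
  rw [coeff_mul, Finset.Nat.sum_antidiagonal_eq_sum_range_succ (fun i j => coeff i P * coeff j geom)]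
  simp [geom]

end PowerSeries

/-! ### Sequences of weights and truncated means -/

/-- A sequence of nonnegative weights, normalised to have weight `1` at `0`. -/
def IsWeight (p : ℕ → ℝ) : Prop := p 0 = 1 ∧ ∀ n, 0 ≤ p n

theorem UpLR.le {p q : ℕ → ℝ} (h : UpLR p q) (hp : IsWeight p) (hq : IsWeight q) (n : ℕ) :
    p n ≤ q n := by
  have := h 0 n 0
  simpa [hp.1, hq.1] using this

namespace PowerSeries

theorem UpLE.mk {p q : ℕ → ℝ} (h : UpLR p q) (hp : IsWeight p) (hq : IsWeight q) :
    UpLE (mk p) (mk q) := by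
  refine ⟨fun n => ?_, fun n => ?_, fun i k l => ?_⟩ <;> simp only [coeff_mk]
  · exact hp.2 n
  · exact hq.2 n
  · exact h i k l

theorem isWeight_coeff_prod {ι : Type*} (s : Finset ι) {p : ι → ℕ → ℝ}
    (h : ∀ i ∈ s, IsWeight (p i)) : IsWeight fun n => coeff n (∏ i ∈ s, mk (p i)) := by
  classical
  constructor
  · change coeff 0 (∏ i ∈ s, mk (p i)) = 1
    rw [coeff_zero_eq_constantCoeff, map_prod]
    apply Finset.prod_eq_one
    intro i hi
    simpa using (h i hi).1
  · intro n
    change 0 ≤ coeff n (∏ i ∈ s, mk (p i))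
    rw [coeff_prod]
    refine Finset.sum_nonneg fun l _ => Finset.prod_nonneg fun i hi => ?_
    rw [coeff_mk]
    exact (h i hi).2 _

theorem one_le_coeff_mul_geom {P : PowerSeries ℝ} (h : IsWeight fun n => coeff n P) (n : ℕ) :
    1 ≤ coeff n (P * geom) := by
  rw [coeff_mul_geom, ← h.1]
  exact Finset.single_le_sum (f := fun i => coeff i P) (fun i _ => h.2 i) (by simp)

/-- Coefficients up to degree `b` of a product depend only on those of the factors. -/
theorem coeff_prod_congr {ι : Type*} (s : Finset ι) {P Q : ι → PowerSeries ℝ} {b : ℕ}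
    (h : ∀ i ∈ s, ∀ n ≤ b, coeff n (P i) = coeff n (Q i)) :
    ∀ n ≤ b, coeff n (∏ i ∈ s, P i) = coeff n (∏ i ∈ s, Q i) := by
  classical
  intro n hn
  rw [coeff_prod, coeff_prod]
  refine Finset.sum_congr rfl fun l hl => Finset.prod_congr rfl fun i hi => h i hi _ ?_
  rw [Finset.mem_finsuppAntidiag] at hl
  calc l i ≤ s.sum l := Finset.single_le_sum (fun j _ => Nat.zero_le _) hi
    _ ≤ b := by rw [hl.1]; exact hn

/-- The Euler operator `X d/dX` on power series. -/
noncomputable def euler (P : PowerSeries ℝ) : PowerSeries ℝ := mk fun n => n * coeff n P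

theorem euler_mul (P Q : PowerSeries ℝ) : euler (P * Q) = euler P * Q + P * euler Q := by
  ext n
  simp only [euler, coeff_mk, map_add, coeff_mul]
  rw [Finset.mul_sum, ← Finset.sum_add_distrib]
  refine Finset.sum_congr rfl fun x hx => ?_
  rw [← Finset.HasAntidiagonal.mem_antidiagonal.1 hx]
  push_cast
  ring

theorem euler_one : euler 1 = 0 := by
  ext n
  simp only [euler, coeff_mk, coeff_one, map_zero]
  split_ifs with h <;> simp [h]

theorem euler_prod {ι : Type*} [DecidableEq ι] (s : Finset ι) (P : ι → PowerSeries ℝ) :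
    euler (∏ i ∈ s, P i) = ∑ i ∈ s, euler (P i) * ∏ j ∈ s.erase i, P j := by
  induction s using Finset.induction_on with
  | empty => simp [euler_one]
  | insert a s ha ih =>
    rw [Finset.prod_insert ha, euler_mul, ih, Finset.sum_insert ha, Finset.erase_insert ha,
      Finset.mul_sum]
    congr 1
    refine Finset.sum_congr rfl fun i hi => ?_
    have hai : a ≠ i := fun h => ha (h ▸ hi)
    rw [Finset.erase_insert_of_ne hai, Finset.prod_insert (fun h => ha (Finset.mem_of_mem_erase h))]
    ring

end PowerSeries

/-- The mean of the probability distribution on `{0, …, b}` with weights proportional to `a`. -/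
noncomputable def truncMean (b : ℕ) (a : ℕ → ℝ) : ℝ :=
  (∑ n ∈ Finset.range (b + 1), n * a n) / ∑ n ∈ Finset.range (b + 1), a n

theorem IsWeight.sum_range_pos {a : ℕ → ℝ} (h : IsWeight a) (b : ℕ) :
    0 < ∑ n ∈ Finset.range (b + 1), a n := by
  have : a 0 ≤ ∑ n ∈ Finset.range (b + 1), a n :=
    Finset.single_le_sum (f := a) (fun i _ => h.2 i) (by simp)
  rw [h.1] at this
  linarith

theorem IsWeight.truncMean_le {a : ℕ → ℝ} (h : IsWeight a) (b : ℕ) : truncMean b a ≤ b := by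
  rw [truncMean, div_le_iff₀ (h.sum_range_pos b), Finset.mul_sum]
  refine Finset.sum_le_sum fun n hn => mul_le_mul_of_nonneg_right ?_ (h.2 n)
  rw [Finset.mem_range] at hn
  exact_mod_cast Nat.le_of_lt_succ hn

/-- The difference of two truncated means, symmetrised over pairs of indices. -/
theorem truncMean_sub {a a' : ℕ → ℝ} (h : IsWeight a) (h' : IsWeight a') (b : ℕ) :
    2 * ((∑ n ∈ Finset.range (b + 1), a n) * (∑ n ∈ Finset.range (b + 1), a' n)) *
        (truncMean b a' - truncMean b a) =
      ∑ i ∈ Finset.range (b + 1), ∑ j ∈ Finset.range (b + 1),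
        ((j : ℝ) - i) * (a i * a' j - a j * a' i) := by
  have e1 : ∑ i ∈ Finset.range (b + 1), ∑ j ∈ Finset.range (b + 1),
        ((j : ℝ) - i) * (a i * a' j - a j * a' i) =
      2 * ((∑ n ∈ Finset.range (b + 1), a n) * (∑ n ∈ Finset.range (b + 1), n * a' n) -
        (∑ n ∈ Finset.range (b + 1), n * a n) * (∑ n ∈ Finset.range (b + 1), a' n)) := by
    have f1 : ∀ (f g : ℕ → ℝ), ∑ i ∈ Finset.range (b + 1), ∑ j ∈ Finset.range (b + 1), f i * g j =
        (∑ n ∈ Finset.range (b + 1), f n) * (∑ n ∈ Finset.range (b + 1), g n) := by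
      intro f g
      rw [Finset.sum_mul_sum]
    have f2 : ∀ i j : ℕ, ((j : ℝ) - i) * (a i * a' j - a j * a' i) =
        (a i * (j * a' j) - (i * a i) * a' j) - (a' i * (j * a j) - (i * a' i) * a j) := by
      intro i j
      ring
    simp only [f2, Finset.sum_sub_distrib, f1]
    ring
  rw [e1, truncMean, truncMean]
  have p1 := (h.sum_range_pos b).ne'
  have p2 := (h'.sum_range_pos b).ne'
  field_simp

theorem UpLR.cross_nonneg {a a' : ℕ → ℝ} (h : UpLR a a') (i j : ℕ) :
    0 ≤ ((j : ℝ) - i) * (a i * a' j - a j * a' i) := by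
  rcases le_total i j with hij | hij
  · obtain ⟨k, rfl⟩ := Nat.exists_eq_add_of_le hij
    have := h i k 0
    simp only [add_zero] at this
    exact mul_nonneg (by push_cast; linarith [(Nat.cast_nonneg k : (0 : ℝ) ≤ k)]) (by linarith)
  · obtain ⟨k, rfl⟩ := Nat.exists_eq_add_of_le hij
    have := h j k 0
    simp only [add_zero] at this
    exact mul_nonneg_of_nonpos_of_nonpos
      (by push_cast; linarith [(Nat.cast_nonneg k : (0 : ℝ) ≤ k)]) (by linarith)

theorem UpLR.truncMean_le {a a' : ℕ → ℝ} (h : UpLR a a') (ha : IsWeight a) (ha' : IsWeight a')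
    (b : ℕ) : truncMean b a ≤ truncMean b a' := by
  have e := truncMean_sub ha ha' b
  have p := mul_pos (ha.sum_range_pos b) (ha'.sum_range_pos b)
  have : 0 ≤ ∑ i ∈ Finset.range (b + 1), ∑ j ∈ Finset.range (b + 1),
        ((j : ℝ) - i) * (a i * a' j - a j * a' i) :=
    Finset.sum_nonneg fun i _ => Finset.sum_nonneg fun j _ => h.cross_nonneg i j
  rw [← e] at this
  have := nonneg_of_mul_nonneg_right this (by linarith)
  linarith

/-- Two weight sequences which are comparable and have equal truncated means agree. -/
theorem UpLR.eq_of_truncMean_eq {a a' : ℕ → ℝ} (h : UpLR a a') (ha : IsWeight a)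
    (ha' : IsWeight a') {b : ℕ} (heq : truncMean b a = truncMean b a') {n : ℕ} (hn : n ≤ b) :
    a n = a' n := by
  have e := truncMean_sub ha ha' b
  rw [heq, sub_self, mul_zero, eq_comm,
    Finset.sum_eq_zero_iff_of_nonneg
      fun i _ => Finset.sum_nonneg fun j _ => h.cross_nonneg i j] at e
  have e0 := e 0 (by simp)
  rw [Finset.sum_eq_zero_iff_of_nonneg fun j _ => h.cross_nonneg 0 j] at e0
  have e1 := e0 n (by rw [Finset.mem_range]; omega)
  rcases Nat.eq_zero_or_pos n with rfl | hn0
  · rw [ha.1, ha'.1]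
  · have : (n : ℝ) ≠ 0 := by exact_mod_cast hn0.ne'
    rw [ha.1, ha'.1] at e1
    simp only [Nat.cast_zero, sub_zero, mul_eq_zero, this, false_or] at e1
    linarith

namespace PowerSeries

/-- If two families of comparable weight sequences have products with the same truncated mean, then
the families agree up to the truncation. -/
theorem eq_of_truncMean_prod_eq {ι : Type*} (s : Finset ι) {p q : ι → ℕ → ℝ} {b : ℕ}
    (hp : ∀ i ∈ s, IsWeight (p i)) (hq : ∀ i ∈ s, IsWeight (q i)) (h : ∀ i ∈ s, UpLR (p i) (q i))
    (heq : truncMean b (fun n => coeff n (∏ i ∈ s, mk (p i))) =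
      truncMean b (fun n => coeff n (∏ i ∈ s, mk (q i)))) :
    ∀ i ∈ s, ∀ n ≤ b, p i n = q i n := by
  classical
  intro i hi n hn
  have hprod := UpLE.prod s fun i hi => UpLE.mk (h i hi) (hp i hi) (hq i hi)
  have e := hprod.2.2.eq_of_truncMean_eq (isWeight_coeff_prod s hp) (isWeight_coeff_prod s hq)
    heq hn
  have hsub : ∀ j ∈ s.erase i, j ∈ s := fun j hj => Finset.mem_of_mem_erase hj
  have wp := isWeight_coeff_prod (s.erase i) fun j hj => hp j (hsub j hj)
  have wq := isWeight_coeff_prod (s.erase i) fun j hj => hq j (hsub j hj)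
  have hle := (UpLE.prod (s.erase i) fun j hj =>
    UpLE.mk (h j (hsub j hj)) (hp j (hsub j hj)) (hq j (hsub j hj))).2.2.le wp wq
  have hpq := (h i hi).le (hp i hi) (hq i hi)
  rw [← Finset.mul_prod_erase s _ hi, ← Finset.mul_prod_erase s _ hi, coeff_mul, coeff_mul,
    Finset.sum_eq_sum_iff_of_le] at e
  · -- in degree `n`, the term with the whole degree in the factor `i` gives the claim
    have := e (n, 0) (by simp)
    have e1 : coeff 0 (∏ j ∈ s.erase i, mk (p j)) = 1 := wp.1
    have e2 : coeff 0 (∏ j ∈ s.erase i, mk (q j)) = 1 := wq.1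
    simpa only [coeff_mk, e1, e2, mul_one] using this
  · intro x _
    simp only [coeff_mk]
    exact mul_le_mul (hpq _) (hle _) (wp.2 _) ((hq i hi).2 _)

/-- A sum over families of natural numbers with bounded total, as a coefficient of a product of
power series. -/
theorem sum_piFinset_eq_coeff {ι : Type*} [Fintype ι] [DecidableEq ι] (p : ι → ℕ → ℝ) {b x : ℕ}
    (hx : x ≤ b) :
    ∑ y ∈ (Fintype.piFinset fun _ : ι => Finset.range (b + 1)) with (∑ d, y d) + x ≤ b,
      ∏ d, p d (y d) = coeff (b - x) ((∏ d, mk (p d)) * geom) := by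
  rw [coeff_mul_geom, ← Finset.sum_fiberwise_of_maps_to (t := Finset.range (b - x + 1))
    (g := fun y : ι → ℕ => ∑ d, y d)]
  · refine Finset.sum_congr rfl fun n hn => ?_
    rw [Finset.mem_range] at hn
    rw [coeff_prod, eq_comm]
    refine Finset.sum_nbij' (fun l => ⇑l) (fun y => Finsupp.equivFunOnFinite.symm y) ?_ ?_ ?_ ?_ ?_
    · intro l hl
      rw [Finset.mem_finsuppAntidiag] at hl
      simp only [Finset.mem_filter, Fintype.mem_piFinset, Finset.mem_range]
      refine ⟨⟨fun i => ?_, ?_⟩, hl.1⟩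
      · have : l i ≤ ∑ d, l d := Finset.single_le_sum (fun j _ => Nat.zero_le _) (Finset.mem_univ i)
        have : ∑ d, l d = n := hl.1
        omega
      · have : ∑ d, l d = n := hl.1
        omega
    · intro y hy
      simp only [Finset.mem_filter] at hy
      rw [Finset.mem_finsuppAntidiag]
      exact ⟨hy.2, Finset.subset_univ _⟩
    · intro l _
      ext; simp
    · intro y _
      ext; simp
    · intro l _
      simp
  · intro y hy
    simp only [Finset.mem_filter, Finset.mem_range] at hy ⊢
    omega

end PowerSeries

namespace Network

open PowerSeries Filter Topology

variable {Ξ : Type u} (N : Network Ξ)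

/-! ### Belief propagation with normalised weights -/

/-- The neighbours of a vertex, as a finite set. -/
noncomputable def nbrs (v : N.V) : Finset N.V := (N.locallyFinite v).toFinset

theorem mem_nbrs {u v : N.V} : u ∈ N.nbrs v ↔ N.graph.Adj v u := by
  simp [nbrs]

open Classical in
/-- The capacity of the edge between two vertices, zero if they are not adjacent. -/
noncomputable def pairCap (u v : N.V) : ℕ :=
  if h : N.graph.Adj u v then N.cap ⟨(u, v), h⟩ else 0

theorem pairCap_of_adj {u v : N.V} (h : N.graph.Adj u v) : N.pairCap u v = N.cap ⟨(u, v), h⟩ :=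
  dif_pos h

theorem pairCap_of_not_adj {u v : N.V} (h : ¬ N.graph.Adj u v) : N.pairCap u v = 0 :=
  dif_neg h

theorem pairCap_comm (u v : N.V) : N.pairCap u v = N.pairCap v u := by
  by_cases h : N.graph.Adj u v
  · rw [N.pairCap_of_adj h, N.pairCap_of_adj h.symm, cap, cap]
    congr 2
    exact Sym2.eq_swap
  · rw [N.pairCap_of_not_adj h, N.pairCap_of_not_adj fun h' => h h'.symm]

open Classical in
/-- The generating function of the number of `y` with `|y| ≤ n`, weighted by the messages from the
neighbours of `v` other than `u`. A family of messages is indexed by all ordered pairs of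
vertices; only its values on adjacent pairs matter. -/
noncomputable def cavity (w : N.V → N.V → ℕ → ℝ) (v u : N.V) : PowerSeries ℝ :=
  (∏ t ∈ (N.nbrs v).erase u, PowerSeries.mk (w t v)) * geom

/-- The belief propagation update, normalised to have value `1` at `0`. -/
noncomputable def weightUpdate (lam : ℝ) (w : N.V → N.V → ℕ → ℝ) (v u : N.V) (x : ℕ) : ℝ :=
  if x ≤ N.pairCap v u ∧ x ≤ N.vertexCap v then
    lam ^ x * coeff (N.vertexCap v - x) (N.cavity w v u) / coeff (N.vertexCap v) (N.cavity w v u)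
  else 0

variable {N} {lam : ℝ}

theorem one_le_coeff_cavity {w : N.V → N.V → ℕ → ℝ} (hw : ∀ u v, IsWeight (w u v)) (v u : N.V)
    (n : ℕ) : 1 ≤ coeff n (N.cavity w v u) :=
  one_le_coeff_mul_geom (isWeight_coeff_prod _ fun _ _ => hw _ _) n

theorem isWeight_weightUpdate (hlam : 0 ≤ lam) {w : N.V → N.V → ℕ → ℝ}
    (hw : ∀ u v, IsWeight (w u v)) (v u : N.V) : IsWeight (N.weightUpdate lam w v u) := by
  have h := one_le_coeff_cavity hw v u
  constructor
  · have := h (N.vertexCap v)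
    simp only [weightUpdate, Nat.zero_le, and_self, if_true, pow_zero, Nat.sub_zero, one_mul]
    exact div_self (by linarith)
  · intro n
    unfold weightUpdate
    split_ifs
    · exact div_nonneg (mul_nonneg (pow_nonneg hlam _) (zero_le_one.trans (h _)))
        (zero_le_one.trans (h _))
    · exact le_rfl

theorem upLE_cavity {w w' : N.V → N.V → ℕ → ℝ} (hw : ∀ u v, IsWeight (w u v))
    (hw' : ∀ u v, IsWeight (w' u v)) (h : ∀ u v, UpLR (w u v) (w' u v)) (v u : N.V) :
    UpLE (N.cavity w v u) (N.cavity w' v u) :=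
  (UpLE.prod _ fun _ _ => UpLE.mk (h _ _) (hw _ _) (hw' _ _)).mul UpLE.geom

/-- The update is antitone for the upshifted likelihood ratio order: it reflects the index of the
coefficients of the cavity series. -/
theorem weightUpdate_antitone (hlam : 0 ≤ lam) {w w' : N.V → N.V → ℕ → ℝ}
    (hw : ∀ u v, IsWeight (w u v)) (hw' : ∀ u v, IsWeight (w' u v))
    (h : ∀ u v, UpLR (w u v) (w' u v)) (v u : N.V) :
    UpLR (N.weightUpdate lam w' v u) (N.weightUpdate lam w v u) := by
  intro i k l
  by_cases hc : i + k + l ≤ N.pairCap v u ∧ i + k + l ≤ N.vertexCap v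
  · have c1 : i ≤ N.pairCap v u ∧ i ≤ N.vertexCap v := by omega
    have c2 : i + k ≤ N.pairCap v u ∧ i + k ≤ N.vertexCap v := by omega
    have c3 : i + l ≤ N.pairCap v u ∧ i + l ≤ N.vertexCap v := by omega
    simp only [weightUpdate, if_pos hc, if_pos c1, if_pos c2, if_pos c3]
    obtain ⟨j, hj⟩ := Nat.exists_eq_add_of_le hc.2
    rw [show N.vertexCap v - (i + k + l) = j by omega, show N.vertexCap v - i = j + k + l by omega,
      show N.vertexCap v - (i + k) = j + l by omega, show N.vertexCap v - (i + l) = j + k by omega]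
    have key := (upLE_cavity hw hw' h v u).2.2 j k l
    have p := one_le_coeff_cavity hw v u (N.vertexCap v)
    have p' := one_le_coeff_cavity hw' v u (N.vertexCap v)
    rw [div_mul_div_comm, div_mul_div_comm]
    apply div_le_div_of_nonneg_right _ (by positivity)
    calc _ = lam ^ (i + k + l + i) * (coeff (j + k + l) (N.cavity w v u) *
          coeff j (N.cavity w' v u)) := by ring
      _ ≤ lam ^ (i + k + l + i) * (coeff (j + l) (N.cavity w v u) *
          coeff (j + k) (N.cavity w' v u)) := by gcongr
      _ = _ := by ring
  · have h0 := isWeight_weightUpdate hlam hw v u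
    have h0' := isWeight_weightUpdate hlam hw' v u
    rw [show N.weightUpdate lam w' v u (i + k + l) = 0 from if_neg hc, zero_mul]
    exact mul_nonneg (h0'.2 _) (h0.2 _)

/-- The update at `(v, u)` depends only on the messages into `v`, up to the capacity of `v`. -/
theorem weightUpdate_congr {w w' : N.V → N.V → ℕ → ℝ} {v : N.V}
    (h : ∀ t ∈ N.nbrs v, ∀ n ≤ N.vertexCap v, w t v n = w' t v n) (u : N.V) :
    N.weightUpdate lam w v u = N.weightUpdate lam w' v u := by
  classical
  have hc : ∀ n ≤ N.vertexCap v, coeff n (N.cavity w v u) = coeff n (N.cavity w' v u) := by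
    intro n hn
    rw [cavity, cavity, coeff_mul_geom, coeff_mul_geom]
    refine Finset.sum_congr rfl fun i hi => ?_
    rw [Finset.mem_range] at hi
    refine coeff_prod_congr _ (b := N.vertexCap v) (fun t ht m hm => ?_) i (by omega)
    rw [coeff_mk, coeff_mk]
    exact h t (Finset.mem_of_mem_erase ht) m hm
  funext x
  rw [weightUpdate, weightUpdate, hc _ (Nat.sub_le _ _), hc _ le_rfl]

theorem tendsto_weightUpdate {w : ℕ → N.V → N.V → ℕ → ℝ} {w' : N.V → N.V → ℕ → ℝ}
    (hw' : ∀ u v, IsWeight (w' u v))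
    (h : ∀ u v x, Tendsto (fun n => w n u v x) atTop (𝓝 (w' u v x))) (v u : N.V) (x : ℕ) :
    Tendsto (fun n => N.weightUpdate lam (w n) v u x) atTop (𝓝 (N.weightUpdate lam w' v u x)) := by
  open scoped PowerSeries.WithPiTopology in
  have hc : ∀ m, Tendsto (fun n => coeff m (N.cavity (w n) v u)) atTop
      (𝓝 (coeff m (N.cavity w' v u))) := by
    rw [← PowerSeries.WithPiTopology.tendsto_iff_coeff_tendsto]
    refine Tendsto.mul (tendsto_finsetProd _ fun t _ => ?_) tendsto_const_nhds
    rw [PowerSeries.WithPiTopology.tendsto_iff_coeff_tendsto]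
    intro m
    simpa only [coeff_mk] using h t v m
  unfold weightUpdate
  split_ifs
  · refine ((hc _).const_mul _).div (hc _) ?_
    have := one_le_coeff_cavity hw' v u (N.vertexCap v)
    linarith
  · exact tendsto_const_nhds

/-! ### The iterates and their two limits -/

variable (N) (lam) in
/-- The iterates of the update, started at the point mass at `0`. -/
noncomputable def weightIter : ℕ → N.V → N.V → ℕ → ℝ
  | 0 => fun _ _ x => if x = 0 then 1 else 0
  | n + 1 => N.weightUpdate lam (weightIter n)

theorem isWeight_weightIter (hlam : 0 ≤ lam) (n : ℕ) (u v : N.V) :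
    IsWeight (N.weightIter lam n u v) := by
  induction n generalizing u v with
  | zero =>
    unfold weightIter
    refine ⟨if_pos rfl, fun x => ?_⟩
    dsimp only
    split_ifs <;> norm_num
  | succ n ih => exact isWeight_weightUpdate hlam ih u v

/-- The point mass at `0` is the least weight sequence. -/
theorem upLR_weightIter_zero {p : ℕ → ℝ} (hp : IsWeight p) (u v : N.V) :
    UpLR (N.weightIter lam 0 u v) p := by
  intro i k l
  unfold weightIter
  have h := hp.2
  by_cases h0 : i + k + l = 0
  · obtain ⟨rfl, rfl, rfl⟩ : i = 0 ∧ k = 0 ∧ l = 0 := by omega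
    simp
  · rw [if_neg h0, zero_mul]
    exact mul_nonneg (by split_ifs <;> norm_num) (h _)

theorem upLR_weightIter (hlam : 0 ≤ lam) {n m : ℕ} (hnm : n ≤ m) :
    (Even n → ∀ u v, UpLR (N.weightIter lam n u v) (N.weightIter lam m u v)) ∧
    (Odd n → ∀ u v, UpLR (N.weightIter lam m u v) (N.weightIter lam n u v)) := by
  induction n generalizing m with
  | zero =>
    exact ⟨fun _ u v => upLR_weightIter_zero (isWeight_weightIter hlam m u v) u v,
      fun h => absurd h (by decide)⟩
  | succ n ih =>
    obtain ⟨m, rfl⟩ : ∃ m', m = m' + 1 := ⟨m - 1, by omega⟩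
    have := ih (m := m) (by omega)
    constructor
    · intro h
      exact weightUpdate_antitone hlam (isWeight_weightIter hlam m) (isWeight_weightIter hlam n)
        (this.2 (by rwa [Nat.even_add_one, Nat.not_even_iff_odd] at h))
    · intro h
      exact weightUpdate_antitone hlam (isWeight_weightIter hlam n) (isWeight_weightIter hlam m)
        (this.1 (by rwa [Nat.odd_add_one, Nat.not_odd_iff_even] at h))

/-- Every fixed point lies between the even and the odd iterates. -/
theorem upLR_weightIter_fixed (hlam : 0 ≤ lam) {w : N.V → N.V → ℕ → ℝ}
    (hw : ∀ u v, IsWeight (w u v)) (hfix : N.weightUpdate lam w = w) (n : ℕ) :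
    (∀ u v, UpLR (N.weightIter lam (2 * n) u v) (w u v)) ∧
    (∀ u v, UpLR (w u v) (N.weightIter lam (2 * n + 1) u v)) := by
  have step : ∀ n, (∀ u v, UpLR (N.weightIter lam (2 * n) u v) (w u v)) →
      ∀ u v, UpLR (w u v) (N.weightIter lam (2 * n + 1) u v) := by
    intro n h
    have := weightUpdate_antitone hlam (isWeight_weightIter hlam (2 * n)) hw h
    rwa [hfix] at this
  have even : ∀ u v, UpLR (N.weightIter lam (2 * n) u v) (w u v) := by
    induction n with
    | zero => exact fun u v => upLR_weightIter_zero (hw u v) u v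
    | succ n ih =>
      have := weightUpdate_antitone hlam hw (isWeight_weightIter hlam (2 * n + 1)) (step n ih)
      rwa [hfix] at this
  exact ⟨even, step n even⟩

variable (N) (lam) in
/-- The increasing limit of the even iterates. -/
noncomputable def weightLow (u v : N.V) (x : ℕ) : ℝ := ⨆ n, N.weightIter lam (2 * n) u v x

variable (N) (lam) in
/-- The decreasing limit of the odd iterates. -/
noncomputable def weightHigh (u v : N.V) (x : ℕ) : ℝ := ⨅ n, N.weightIter lam (2 * n + 1) u v x

theorem tendsto_weightLow (hlam : 0 ≤ lam) (u v : N.V) (x : ℕ) :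
    Tendsto (fun n => N.weightIter lam (2 * n) u v x) atTop (𝓝 (N.weightLow lam u v x)) := by
  have hw := isWeight_weightIter (N := N) hlam
  apply tendsto_atTop_ciSup
  · intro n m hnm
    exact ((upLR_weightIter hlam (by omega : 2 * n ≤ 2 * m)).1 (even_two_mul n) u v).le
      (hw _ u v) (hw _ u v) x
  · refine ⟨N.weightIter lam 1 u v x, ?_⟩
    rintro _ ⟨n, rfl⟩
    rcases Nat.eq_zero_or_pos n with rfl | hn
    · exact ((upLR_weightIter hlam (by omega : 2 * 0 ≤ 1)).1 (by decide) u v).le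
        (hw _ u v) (hw _ u v) x
    · exact ((upLR_weightIter hlam (by omega : 1 ≤ 2 * n)).2 (by decide) u v).le
        (hw _ u v) (hw _ u v) x

theorem tendsto_weightHigh (hlam : 0 ≤ lam) (u v : N.V) (x : ℕ) :
    Tendsto (fun n => N.weightIter lam (2 * n + 1) u v x) atTop (𝓝 (N.weightHigh lam u v x)) := by
  have hw := isWeight_weightIter (N := N) hlam
  apply tendsto_atTop_ciInf
  · intro n m hnm
    exact ((upLR_weightIter hlam (by omega : 2 * n + 1 ≤ 2 * m + 1)).2 (odd_two_mul_add_one n)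
      u v).le (hw _ u v) (hw _ u v) x
  · refine ⟨0, ?_⟩
    rintro _ ⟨n, rfl⟩
    exact (hw _ u v).2 x

theorem isWeight_of_tendsto {p : ℕ → ℕ → ℝ} {q : ℕ → ℝ} (hp : ∀ n, IsWeight (p n))
    (h : ∀ x, Tendsto (fun n => p n x) atTop (𝓝 (q x))) : IsWeight q := by
  constructor
  · refine tendsto_nhds_unique (h 0) ?_
    simp only [(hp _).1]
    exact tendsto_const_nhds
  · exact fun x => ge_of_tendsto' (h x) fun n => (hp n).2 x

theorem isWeight_weightLow (hlam : 0 ≤ lam) (u v : N.V) : IsWeight (N.weightLow lam u v) :=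
  isWeight_of_tendsto (fun n => isWeight_weightIter hlam (2 * n) u v) (tendsto_weightLow hlam u v)

theorem isWeight_weightHigh (hlam : 0 ≤ lam) (u v : N.V) : IsWeight (N.weightHigh lam u v) :=
  isWeight_of_tendsto (fun n => isWeight_weightIter hlam (2 * n + 1) u v)
    (tendsto_weightHigh hlam u v)

theorem upLR_weightLow_weightHigh (hlam : 0 ≤ lam) (u v : N.V) :
    UpLR (N.weightLow lam u v) (N.weightHigh lam u v) := by
  intro i k l
  refine le_of_tendsto_of_tendsto'
    ((tendsto_weightLow hlam u v _).mul (tendsto_weightHigh hlam u v _))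
    ((tendsto_weightLow hlam u v _).mul (tendsto_weightHigh hlam u v _)) fun n => ?_
  exact (upLR_weightIter hlam (by omega : 2 * n ≤ 2 * n + 1)).1 (even_two_mul n) u v i k l

theorem weightUpdate_weightLow (hlam : 0 ≤ lam) :
    N.weightUpdate lam (N.weightLow lam) = N.weightHigh lam := by
  funext v u x
  exact tendsto_nhds_unique
    (tendsto_weightUpdate (isWeight_weightLow hlam) (tendsto_weightLow hlam) v u x)
    (tendsto_weightHigh hlam v u x)

theorem weightUpdate_weightHigh (hlam : 0 ≤ lam) :
    N.weightUpdate lam (N.weightHigh lam) = N.weightLow lam := by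
  funext v u x
  refine tendsto_nhds_unique
    (tendsto_weightUpdate (isWeight_weightHigh hlam) (tendsto_weightHigh hlam) v u x) ?_
  exact (tendsto_weightLow hlam v u x).comp (tendsto_add_atTop_nat 1)

/-! ### Edge loads and vertex loads -/

/-- The mean value of an edge under weights proportional to `p x * q x / lam ^ x`, where `p` and `q`
are the messages along the two directions of the edge. Both messages contain the factor `lam ^ x`,
which must be counted once. For `lam = 0` the terms with `x ≠ 0` are divisions by zero, hence zero, in
accordance with the messages being point masses at `0`. -/
noncomputable def _root_.edgeLoad (lam : ℝ) (c : ℕ) (p q : ℕ → ℝ) : ℝ :=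
  (∑ x ∈ Finset.range (c + 1), x * (p x * q x / lam ^ x)) /
    ∑ x ∈ Finset.range (c + 1), p x * q x / lam ^ x

theorem _root_.edgeLoad_comm (lam : ℝ) (c : ℕ) (p q : ℕ → ℝ) :
    edgeLoad lam c p q = edgeLoad lam c q p := by
  simp only [edgeLoad, mul_comm (p _)]

theorem _root_.edgeLoad_zero (lam : ℝ) (p q : ℕ → ℝ) : edgeLoad lam 0 p q = 0 := by
  simp [edgeLoad]

theorem _root_.edgeLoad_nonneg {lam : ℝ} (hlam : 0 ≤ lam) (c : ℕ) {p q : ℕ → ℝ} (hp : IsWeight p)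
    (hq : IsWeight q) : 0 ≤ edgeLoad lam c p q := by
  have h : ∀ x, 0 ≤ p x * q x / lam ^ x := fun x =>
    div_nonneg (mul_nonneg (hp.2 x) (hq.2 x)) (pow_nonneg hlam x)
  exact div_nonneg (Finset.sum_nonneg fun x _ => mul_nonneg x.cast_nonneg (h x))
    (Finset.sum_nonneg fun x _ => h x)

theorem _root_.tendsto_edgeLoad {lam : ℝ} (hlam : 0 ≤ lam) (c : ℕ) {p q : ℕ → ℕ → ℝ}
    {p' q' : ℕ → ℝ} (hp' : IsWeight p') (hq' : IsWeight q')
    (hp : ∀ x, Tendsto (fun n => p n x) atTop (𝓝 (p' x)))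
    (hq : ∀ x, Tendsto (fun n => q n x) atTop (𝓝 (q' x))) :
    Tendsto (fun n => edgeLoad lam c (p n) (q n)) atTop (𝓝 (edgeLoad lam c p' q')) := by
  have h : ∀ x, Tendsto (fun n => p n x * q n x / lam ^ x) atTop (𝓝 (p' x * q' x / lam ^ x)) :=
    fun x => ((hp x).mul (hq x)).div_const _
  refine (tendsto_finsetSum _ fun x _ => (h x).const_mul _).div
    (tendsto_finsetSum _ fun x _ => h x) ?_
  have := (show IsWeight fun x => p' x * q' x / lam ^ x from
    ⟨by simp [hp'.1, hq'.1], fun x => by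
      have := hp'.2 x
      have := hq'.2 x
      positivity⟩).sum_range_pos c
  exact this.ne'

variable (N) in
/-- The mean total load of `v`, when the messages into `v` are conditioned to have total at most the
capacity of `v`. -/
noncomputable def vertexLoad (w : N.V → N.V → ℕ → ℝ) (v : N.V) : ℝ :=
  truncMean (N.vertexCap v) fun n => coeff n (∏ t ∈ N.nbrs v, PowerSeries.mk (w t v))

theorem weightUpdate_ne_zero {w : N.V → N.V → ℕ → ℝ} {v u : N.V} {x : ℕ}
    (h : N.weightUpdate lam w v u x ≠ 0) : x ≤ N.pairCap v u ∧ lam ^ x ≠ 0 := by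
  unfold weightUpdate at h
  split_ifs at h with hc
  · refine ⟨hc.1, fun h0 => h ?_⟩
    rw [h0, zero_mul, zero_div]
  · exact absurd rfl h

/-- The vertex load is the sum of the loads of the incident edges. -/
theorem sum_edgeLoad {w : N.V → N.V → ℕ → ℝ} (hw : ∀ u v, IsWeight (w u v))
    (hsupp : ∀ u v x, w u v x ≠ 0 → x ≤ N.pairCap u v ∧ lam ^ x ≠ 0) (v : N.V) :
    ∑ u ∈ N.nbrs v, edgeLoad lam (N.pairCap v u) (w u v) (N.weightUpdate lam w v u) =
      N.vertexLoad w v := by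
  classical
  set b := N.vertexCap v with hb
  set P := ∏ t ∈ N.nbrs v, PowerSeries.mk (w t v) with hP
  have hsum : ∀ u (g : ℕ → ℝ), ∑ x ∈ Finset.range (N.pairCap v u + 1),
      g x * (w u v x * N.weightUpdate lam w v u x / lam ^ x) =
      coeff b (PowerSeries.mk (fun x => g x * w u v x) * N.cavity w v u) / coeff b (N.cavity w v u) := by
    intro u g
    rw [coeff_mul, Finset.Nat.sum_antidiagonal_eq_sum_range_succ
      (fun i j => coeff i (PowerSeries.mk fun x => g x * w u v x) * coeff j (N.cavity w v u)), Finset.sum_div]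
    simp only [coeff_mk]
    have e1 : ∑ x ∈ Finset.range (N.pairCap v u + 1),
        g x * (w u v x * N.weightUpdate lam w v u x / lam ^ x) =
        ∑ x ∈ Finset.range (min (N.pairCap v u) b + 1),
        g x * (w u v x * N.weightUpdate lam w v u x / lam ^ x) := by
      symm
      apply Finset.sum_subset
      · intro x
        simp only [Finset.mem_range]
        omega
      · intro x hx hx'
        simp only [Finset.mem_range] at hx hx'
        rw [weightUpdate, if_neg (by omega)]
        simp
    have e2 : ∑ x ∈ Finset.range (b + 1), g x * w u v x * coeff (b - x) (N.cavity w v u) /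
          coeff b (N.cavity w v u) =
        ∑ x ∈ Finset.range (min (N.pairCap v u) b + 1),
          g x * w u v x * coeff (b - x) (N.cavity w v u) / coeff b (N.cavity w v u) := by
      symm
      apply Finset.sum_subset
      · intro x
        simp only [Finset.mem_range]
        omega
      · intro x hx hx'
        simp only [Finset.mem_range] at hx hx'
        have : w u v x = 0 := by
          by_contra h0
          have := (hsupp u v x h0).1
          rw [N.pairCap_comm] at this
          omega
        simp [this]
    rw [e1, e2]
    refine Finset.sum_congr rfl fun x hx => ?_
    rw [Finset.mem_range] at hx
    by_cases h0 : w u v x = 0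
    · simp [h0]
    · have hl := (hsupp u v x h0).2
      rw [weightUpdate, if_pos (by omega), ← hb]
      field_simp
  have hload : ∀ u ∈ N.nbrs v, edgeLoad lam (N.pairCap v u) (w u v) (N.weightUpdate lam w v u) =
      coeff b (euler (PowerSeries.mk (w u v)) * (∏ t ∈ (N.nbrs v).erase u, PowerSeries.mk (w t v)) * geom) /
        coeff b (P * geom) := by
    intro u hu
    have h1 := hsum u fun x => x
    have h2 := hsum u fun _ => 1
    simp only [one_mul] at h2
    rw [edgeLoad, h1, h2, div_div_div_cancel_right₀
      (by have := one_le_coeff_cavity hw v u b; linarith), hP,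
      ← Finset.mul_prod_erase _ _ hu, mul_assoc, mul_assoc]
    simp only [cavity, euler, coeff_mk]
  rw [Finset.sum_congr rfl hload, ← Finset.sum_div, ← map_sum, ← Finset.sum_mul, ← euler_prod,
    coeff_mul_geom, coeff_mul_geom, vertexLoad, truncMean]
  simp only [euler, coeff_mk, hP, hb]

theorem vertexLoad_weightLow (hlam : 0 ≤ lam) (v : N.V) :
    ∑ u ∈ N.nbrs v, edgeLoad lam (N.pairCap v u) (N.weightLow lam u v) (N.weightHigh lam v u) =
      N.vertexLoad (N.weightLow lam) v := by
  rw [← weightUpdate_weightLow hlam]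
  refine sum_edgeLoad (isWeight_weightLow hlam) (fun u v x h => ?_) v
  rw [← weightUpdate_weightHigh hlam] at h
  exact weightUpdate_ne_zero h

theorem vertexLoad_weightHigh (hlam : 0 ≤ lam) (v : N.V) :
    ∑ u ∈ N.nbrs v, edgeLoad lam (N.pairCap u v) (N.weightLow lam v u) (N.weightHigh lam u v) =
      N.vertexLoad (N.weightHigh lam) v := by
  rw [← sum_edgeLoad (lam := lam) (isWeight_weightHigh hlam)]
  · refine Finset.sum_congr rfl fun u _ => ?_
    rw [edgeLoad_comm, N.pairCap_comm, weightUpdate_weightHigh hlam]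
  · intro u v x h
    rw [← weightUpdate_weightLow hlam] at h
    exact weightUpdate_ne_zero h

theorem vertexLoad_le (hlam : 0 ≤ lam) (v : N.V) :
    N.vertexLoad (N.weightLow lam) v ≤ N.vertexLoad (N.weightHigh lam) v :=
  (UpLE.prod _ fun _ _ => UpLE.mk (upLR_weightLow_weightHigh hlam _ _)
    (isWeight_weightLow hlam _ _) (isWeight_weightHigh hlam _ _)).2.2.truncMean_le
    (isWeight_coeff_prod _ fun _ _ => isWeight_weightLow hlam _ _)
    (isWeight_coeff_prod _ fun _ _ => isWeight_weightHigh hlam _ _) _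

theorem vertexLoad_le_vertexCap {w : N.V → N.V → ℕ → ℝ} (hw : ∀ u v, IsWeight (w u v)) (v : N.V) :
    N.vertexLoad w v ≤ N.vertexCap v :=
  (isWeight_coeff_prod _ fun _ _ => hw _ _).truncMean_le _

/-- If the two limits give every vertex the same load, then they coincide. -/
theorem weightLow_eq_weightHigh (hlam : 0 ≤ lam)
    (h : ∀ v, N.vertexLoad (N.weightLow lam) v = N.vertexLoad (N.weightHigh lam) v) :
    N.weightLow lam = N.weightHigh lam := by
  suffices N.weightUpdate lam (N.weightHigh lam) = N.weightUpdate lam (N.weightLow lam) by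
    rwa [weightUpdate_weightHigh hlam, weightUpdate_weightLow hlam] at this
  funext v u
  refine weightUpdate_congr (fun t ht n hn => ?_) u
  exact (eq_of_truncMean_prod_eq (N.nbrs v) (fun _ _ => isWeight_weightLow hlam _ _)
    (fun _ _ => isWeight_weightHigh hlam _ _) (fun _ _ => upLR_weightLow_weightHigh hlam _ _)
    (h v) t ht n hn).symm

end Network

namespace Network

open PowerSeries Filter Topology

variable {Ξ : Type u} {N : Network Ξ} {lam : ℝ}

/-! ### Fixed points of the normalised and of the original update -/

theorem prod_inputs {M : Type*} [CommMonoid M] [DecidableEq N.V] (F : N.V → N.V → M)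
    (e : N.graph.Dart) :
    ∏ d : N.Inputs e, F d.1.fst d.1.snd = ∏ t ∈ (N.nbrs e.fst).erase e.snd, F t e.fst := by
  refine Finset.prod_bij (fun d _ => d.1.fst) ?_ ?_ ?_ ?_
  · intro d _
    rw [Finset.mem_erase, mem_nbrs]
    have h := d.1.adj.symm
    rw [d.2.1] at h
    exact ⟨d.2.2, h⟩
  · intro d _ d' _ h
    exact Subtype.ext (SimpleGraph.Dart.ext _ _ (Prod.ext h (d.2.1.trans d'.2.1.symm)))
  · intro t ht
    rw [Finset.mem_erase, mem_nbrs] at ht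
    exact ⟨⟨⟨(t, e.fst), ht.2.symm⟩, rfl, ht.1⟩, Finset.mem_univ _, rfl⟩
  · intro d _
    rw [d.2.1]

theorem inputSum_eq {m : N.graph.Dart → ℕ → ℝ} {w : N.V → N.V → ℕ → ℝ} {κ : N.graph.Dart → ℝ}
    (hm : ∀ d x, m d x = κ d * w d.fst d.snd x) (e : N.graph.Dart) (x : ℕ) :
    N.inputSum m e x = (∏ d : N.Inputs e, κ d.1) *
      if x ≤ N.vertexCap e.fst then coeff (N.vertexCap e.fst - x) (N.cavity w e.fst e.snd)
      else 0 := by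
  classical
  have h : N.inputSum m e x = (∏ d : N.Inputs e, κ d.1) *
      ∑ y ∈ (Fintype.piFinset fun _ : N.Inputs e => Finset.range (N.vertexCap e.fst + 1)) with
        (∑ d, y d) + x ≤ N.vertexCap e.fst, ∏ d : N.Inputs e, w d.1.fst d.1.snd (y d) := by
    rw [inputSum, Finset.mul_sum]
    refine Finset.sum_congr (by congr!) fun y _ => ?_
    rw [← Finset.prod_mul_distrib]
    exact Finset.prod_congr rfl fun d _ => hm _ _
  rw [h]
  congr 1
  split_ifs with hx
  · rw [sum_piFinset_eq_coeff (fun d : N.Inputs e => w d.1.fst d.1.snd) hx,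
      prod_inputs (fun t v => PowerSeries.mk (w t v)) e, cavity]
  · rw [Finset.filter_false_of_mem, Finset.sum_empty]
    intro y _
    omega

/-- The original update is the normalised one, divided by its total mass; it is insensitive to
scaling of the messages. -/
theorem bpUpdate_eq {m : N.graph.Dart → ℕ → ℝ} {w : N.V → N.V → ℕ → ℝ} {κ : N.graph.Dart → ℝ}
    (hw : ∀ u v, IsWeight (w u v)) (hκ : ∀ d, κ d ≠ 0)
    (hm : ∀ d x, m d x = κ d * w d.fst d.snd x) (e : N.graph.Dart) (x : ℕ) :
    N.bpUpdate lam m e x = N.weightUpdate lam w e.fst e.snd x /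
      ∑ t ∈ Finset.range (N.pairCap e.fst e.snd + 1), N.weightUpdate lam w e.fst e.snd t := by
  have hcap : N.pairCap e.fst e.snd = N.cap e := N.pairCap_of_adj e.adj
  set b := N.vertexCap e.fst with hb
  set K := (∏ d : N.Inputs e, κ d.1) * coeff b (N.cavity w e.fst e.snd) with hK
  have hc := one_le_coeff_cavity hw e.fst e.snd b
  have hK0 : K ≠ 0 := mul_ne_zero (Finset.prod_ne_zero_iff.2 fun d _ => hκ _) (by linarith)
  have key : ∀ t ≤ N.cap e, lam ^ t * N.inputSum m e t =
      K * N.weightUpdate lam w e.fst e.snd t := by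
    intro t ht
    rw [inputSum_eq hm, weightUpdate, hcap, hK]
    by_cases htb : t ≤ b
    · have hc0 : coeff b (N.cavity w e.fst e.snd) ≠ 0 := by linarith
      rw [if_pos htb, if_pos ⟨ht, htb⟩, ← hb]
      field_simp
    · rw [if_neg htb, if_neg fun h => htb h.2]
      simp
  have hden : ∑ t ∈ Finset.range (N.cap e + 1), lam ^ t * N.inputSum m e t =
      K * ∑ t ∈ Finset.range (N.cap e + 1), N.weightUpdate lam w e.fst e.snd t := by
    rw [Finset.mul_sum]
    refine Finset.sum_congr rfl fun t ht => key t ?_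
    rw [Finset.mem_range] at ht
    omega
  have hnum : (if x ≤ N.cap e then lam ^ x * N.inputSum m e x else 0) =
      K * N.weightUpdate lam w e.fst e.snd x := by
    split_ifs with hx
    · exact key x hx
    · rw [weightUpdate, hcap, if_neg fun h => hx h.1, mul_zero]
  rw [bpUpdate, hden, hnum, hcap, mul_div_mul_left _ _ hK0]

theorem isMessage_weightUpdate (hlam : 0 ≤ lam) {w : N.V → N.V → ℕ → ℝ}
    (hw : ∀ u v, IsWeight (w u v)) (v u : N.V) :
    IsMessage fun x => N.weightUpdate lam w v u x /
      ∑ t ∈ Finset.range (N.pairCap v u + 1), N.weightUpdate lam w v u t := by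
  have hU := isWeight_weightUpdate hlam hw v u
  set U := N.weightUpdate lam w v u with hUdef
  set Z := ∑ t ∈ Finset.range (N.pairCap v u + 1), U t with hZ
  have hZ0 : 0 < Z := hU.sum_range_pos _
  have hzero : ∀ x, N.pairCap v u < x → U x = 0 := by
    intro x hx
    rw [hUdef, weightUpdate, if_neg (by omega)]
  refine ⟨fun x => ⟨div_nonneg (hU.2 x) hZ0.le, ?_⟩, ?_, ⟨N.pairCap v u, fun x hx => ?_⟩, ?_, ?_⟩
  · rw [div_le_one hZ0]
    rcases le_or_gt x (N.pairCap v u) with hx | hx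
    · exact Finset.single_le_sum (f := U) (fun t _ => hU.2 t) (by rw [Finset.mem_range]; omega)
    · rw [hzero x hx]
      exact hZ0.le
  · have : HasSum U Z := hasSum_sum_of_ne_finset_zero fun x hx => hzero x (by
      rw [Finset.mem_range] at hx; omega)
    have := this.div_const Z
    rwa [div_self hZ0.ne'] at this
  · simp only [hzero x hx, zero_div]
  · -- the support consists of the `x` up to both capacities with `lam ^ x ≠ 0`
    have hsupp : ∀ x, U x / Z ≠ 0 ↔
        (x ≤ N.pairCap v u ∧ x ≤ N.vertexCap v) ∧ lam ^ x ≠ 0 := by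
      intro x
      have h1 := one_le_coeff_cavity hw v u (N.vertexCap v)
      have h2 := one_le_coeff_cavity hw v u (N.vertexCap v - x)
      rw [hUdef, weightUpdate]
      split_ifs with hc
      · simp only [ne_eq, div_eq_zero_iff, mul_eq_zero, hZ0.ne', hc]
        have h1' : coeff (N.vertexCap v) (N.cavity w v u) ≠ 0 := by linarith
        have h2' : coeff (N.vertexCap v - x) (N.cavity w v u) ≠ 0 := by linarith
        simp [h1', h2']
      · simp [hc]
    refine ⟨fun x hx z hz y hy => ?_⟩
    rw [Function.mem_support, hsupp] at hx hz ⊢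
    obtain ⟨hxy, hyz⟩ := hy
    refine ⟨by omega, fun h => hz.2 ?_⟩
    obtain ⟨k, rfl⟩ := Nat.exists_eq_add_of_le hyz
    rw [pow_add, h, zero_mul]
  · rw [Function.mem_support, hU.1]
    exact (div_pos one_pos hZ0).ne'

/-- A fixed point of the original update comes from a fixed point of the normalised one. -/
theorem exists_weight_of_isBPFixedPoint {m : N.graph.Dart → ℕ → ℝ}
    (hm : N.IsBPFixedPoint lam m) :
    ∃ w : N.V → N.V → ℕ → ℝ, (∀ u v, IsWeight (w u v)) ∧ N.weightUpdate lam w = w ∧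
      ∀ e x, m e x = w e.fst e.snd x /
        ∑ t ∈ Finset.range (N.pairCap e.fst e.snd + 1), w e.fst e.snd t := by
  classical
  obtain ⟨hmsg, hfix⟩ := hm
  have hm0 : ∀ d, m d 0 ≠ 0 := fun d => (hmsg d).2.2.2.2
  set w : N.V → N.V → ℕ → ℝ := fun u v x =>
    if h : N.graph.Adj u v then m ⟨(u, v), h⟩ x / m ⟨(u, v), h⟩ 0 else if x = 0 then 1 else 0 with hw
  have hwadj : ∀ (d : N.graph.Dart) x, w d.fst d.snd x = m d x / m d 0 := fun d x => dif_pos d.adj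
  have hweight : ∀ u v, IsWeight (w u v) := by
    intro u v
    by_cases h : N.graph.Adj u v
    · exact ⟨by simp only [hw, dif_pos h]; exact div_self (hm0 _), fun x => by
        simp only [hw, dif_pos h]
        exact div_nonneg ((hmsg _).1 x).1 ((hmsg _).1 0).1⟩
    · exact ⟨by simp only [hw, dif_neg h, if_true], fun x => by
        simp only [hw, dif_neg h]
        split_ifs <;> norm_num⟩
  have hmw : ∀ d x, m d x = m d 0 * w d.fst d.snd x := by
    intro d x
    rw [hwadj, mul_div_cancel₀ _ (hm0 d)]
  have hupd : ∀ (e : N.graph.Dart) x, m e x = N.weightUpdate lam w e.fst e.snd x /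
      ∑ t ∈ Finset.range (N.pairCap e.fst e.snd + 1), N.weightUpdate lam w e.fst e.snd t := by
    intro e x
    rw [← bpUpdate_eq hweight hm0 hmw e x, ← hfix]
  have hone : ∀ v u, N.weightUpdate lam w v u 0 = 1 := by
    intro v u
    have := one_le_coeff_cavity hweight v u (N.vertexCap v)
    simp only [weightUpdate, Nat.zero_le, and_self, if_true, pow_zero, Nat.sub_zero, one_mul]
    exact div_self (by linarith)
  have hwfix : N.weightUpdate lam w = w := by
    funext u v x
    by_cases h : N.graph.Adj u v
    · have h0 := hm0 ⟨(u, v), h⟩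
      have e1 := hwadj ⟨(u, v), h⟩ x
      rw [hupd ⟨(u, v), h⟩ 0] at h0
      rw [hupd ⟨(u, v), h⟩ x, hupd ⟨(u, v), h⟩ 0] at e1
      simp only [hone] at e1 h0
      rw [e1, div_div_div_cancel_right₀ (fun h' => h0 (by rw [h', div_zero])), div_one]
    · rcases Nat.eq_zero_or_pos x with rfl | hx
      · rw [hone, (hweight u v).1]
      · simp only [hw, dif_neg h, if_neg hx.ne']
        rw [weightUpdate, N.pairCap_of_not_adj h, if_neg (by omega)]
  refine ⟨w, hweight, hwfix, fun e x => ?_⟩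
  have := hupd e x
  rwa [hwfix] at this

/-- If the even and the odd iterates have the same limit, then the fixed point exists and is
unique. -/
theorem existsUnique_isBPFixedPoint (hlam : 0 ≤ lam)
    (h : N.weightLow lam = N.weightHigh lam) : ∃! m, N.IsBPFixedPoint lam m := by
  set w := N.weightLow lam with hw
  have hweight : ∀ u v, IsWeight (w u v) := isWeight_weightLow hlam
  have hfix : N.weightUpdate lam w = w := by rw [hw, weightUpdate_weightLow hlam, ← h]
  refine ⟨fun e x => w e.fst e.snd x /
    ∑ t ∈ Finset.range (N.pairCap e.fst e.snd + 1), w e.fst e.snd t, ⟨fun e => ?_, ?_⟩, ?_⟩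
  · have := isMessage_weightUpdate hlam hweight e.fst e.snd
    rwa [hfix] at this
  · funext e x
    rw [bpUpdate_eq (w := w) hweight (fun d => inv_ne_zero ((hweight d.fst d.snd).sum_range_pos
      (N.pairCap d.fst d.snd)).ne') (fun d x => div_eq_inv_mul _ _) e x, hfix]
  · intro m hm
    obtain ⟨w', hweight', hfix', hm'⟩ := exists_weight_of_isBPFixedPoint hm
    have hww : w' = w := by
      funext u v x
      have hbd := upLR_weightIter_fixed hlam hweight' hfix'
      apply le_antisymm
      · rw [h]
        exact ge_of_tendsto' (tendsto_weightHigh hlam u v x) fun n =>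
          ((hbd n).2 u v).le (hweight' u v) (isWeight_weightIter hlam _ u v) x
      · exact le_of_tendsto' (tendsto_weightLow hlam u v x) fun n =>
          ((hbd n).1 u v).le (isWeight_weightIter hlam _ u v) (hweight' u v) x
    funext e x
    rw [hm', hww]

end Network

/-! ### Capacity-preserving isomorphisms between balls -/

/-- The rooted network obtained by choosing the root `v`. -/
def Network.rootAt {Ξ : Type u} (N : Network Ξ) (v : N.V) : RootedNetwork Ξ 1 := ⟨N, fun _ => v⟩

namespace RootedNetwork

open Filter Topology

variable {Ξ : Type u} {k l : ℕ}

theorem rootAt_root (A : RootedNetwork Ξ 1) : A.rootAt (A.root 0) = A := by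
  obtain ⟨N, r⟩ := A
  simp only [Network.rootAt, mk.injEq, heq_eq_eq, true_and]
  funext i
  rw [Subsingleton.elim i 0]

/-- The maps `φ` and `ψ` restrict to mutually inverse isomorphisms between the balls of radius `n`,
respecting the distinguished vertices and the capacities, but not necessarily the marks. -/
structure BallMap (n : ℕ) (A B : RootedNetwork Ξ k) (φ : A.V → B.V) (ψ : B.V → A.V) : Prop where
  root : ∀ i, φ (A.root i) = B.root i
  mapsTo : ∀ x ∈ A.ball n, φ x ∈ B.ball n
  mapsTo_symm : ∀ y ∈ B.ball n, ψ y ∈ A.ball n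
  left_inv : ∀ x ∈ A.ball n, ψ (φ x) = x
  right_inv : ∀ y ∈ B.ball n, φ (ψ y) = y
  adj : ∀ x ∈ A.ball n, ∀ y ∈ A.ball n, B.graph.Adj (φ x) (φ y) ↔ A.graph.Adj x y
  vertexCap : ∀ x ∈ A.ball n, B.vertexCap (φ x) = A.vertexCap x
  pairCap : ∀ x ∈ A.ball n, ∀ y ∈ A.ball n, B.pairCap (φ x) (φ y) = A.pairCap x y

theorem ball_mono (A : RootedNetwork Ξ k) {n m : ℕ} (h : n ≤ m) : A.ball n ⊆ A.ball m :=
  fun _ ⟨i, hi⟩ => ⟨i, hi.trans h⟩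

theorem mem_ball_of_dist_le (A : RootedNetwork Ξ k) {a j : ℕ} {x y : A.V} (hx : x ∈ A.ball a)
    (h : A.graph.dist x y ≤ j) : y ∈ A.ball (a + j) := by
  obtain ⟨i, hi⟩ := hx
  exact ⟨i, A.connected.dist_triangle.trans (add_le_add hi h)⟩

theorem mem_ball_of_adj (A : RootedNetwork Ξ k) {a : ℕ} {x y : A.V} (hx : x ∈ A.ball a)
    (h : A.graph.Adj x y) : y ∈ A.ball (a + 1) :=
  A.mem_ball_of_dist_le hx (SimpleGraph.dist_eq_one_iff_adj.2 h).le

namespace BallMap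

variable {n : ℕ} {A B : RootedNetwork Ξ k} {φ : A.V → B.V} {ψ : B.V → A.V}

theorem symm (h : BallMap n A B φ ψ) : BallMap n B A ψ φ where
  root i := by rw [← h.root i, h.left_inv _ (A.root_mem_ball n i)]
  mapsTo := h.mapsTo_symm
  mapsTo_symm := h.mapsTo
  left_inv := h.right_inv
  right_inv := h.left_inv
  adj x hx y hy := by
    rw [← h.adj _ (h.mapsTo_symm x hx) _ (h.mapsTo_symm y hy), h.right_inv x hx, h.right_inv y hy]
  vertexCap x hx := by rw [← h.vertexCap _ (h.mapsTo_symm x hx), h.right_inv x hx]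
  pairCap x hx y hy := by
    rw [← h.pairCap _ (h.mapsTo_symm x hx) _ (h.mapsTo_symm y hy), h.right_inv x hx,
      h.right_inv y hy]

theorem exists_walk (h : BallMap n A B φ ψ) {x y : A.V} (p : A.graph.Walk x y) {a : ℕ}
    (hx : x ∈ A.ball a) (hn : a + p.length ≤ n) :
    ∃ q : B.graph.Walk (φ x) (φ y), q.length = p.length := by
  induction p generalizing a with
  | nil => exact ⟨SimpleGraph.Walk.nil, rfl⟩
  | cons hadj p ih =>
    rw [SimpleGraph.Walk.length_cons] at hn
    have hz := A.mem_ball_of_adj hx hadj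
    obtain ⟨q, hq⟩ := ih hz (by omega)
    refine ⟨SimpleGraph.Walk.cons ((h.adj _ (A.ball_mono (by omega) hx) _
      (A.ball_mono (by omega) hz)).2 hadj) q, ?_⟩
    rw [SimpleGraph.Walk.length_cons, SimpleGraph.Walk.length_cons, hq]

theorem dist_le (h : BallMap n A B φ ψ) {x y : A.V} {a j : ℕ} (hx : x ∈ A.ball a)
    (hxy : A.graph.dist x y ≤ j) (hn : a + j ≤ n) : B.graph.dist (φ x) (φ y) ≤ j := by
  obtain ⟨p, hp⟩ := A.connected.exists_walk_length_eq_dist x y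
  obtain ⟨q, hq⟩ := h.exists_walk p hx (by omega)
  calc B.graph.dist (φ x) (φ y) ≤ q.length := SimpleGraph.dist_le q
    _ ≤ j := by omega

theorem mem_ball (h : BallMap n A B φ ψ) {x : A.V} {a : ℕ} (hx : x ∈ A.ball a) (hn : a ≤ n) :
    φ x ∈ B.ball a := by
  obtain ⟨i, hi⟩ := hx
  refine ⟨i, ?_⟩
  rw [← h.root i]
  exact h.dist_le (A.root_mem_ball 0 i) hi (by omega)

/-- Change of the distinguished vertices. -/
theorem reroot (h : BallMap n A B φ ψ) {r : Fin l → A.V} {s : Fin l → B.V} {a m : ℕ}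
    (hr : ∀ i, r i ∈ A.ball a) (hs : ∀ i, φ (r i) = s i) (hn : a + m ≤ n) :
    BallMap m (⟨A.toNetwork, r⟩ : RootedNetwork Ξ l) ⟨B.toNetwork, s⟩ φ ψ := by
  have hsub : ∀ x ∈ (⟨A.toNetwork, r⟩ : RootedNetwork Ξ l).ball m, x ∈ A.ball n := by
    rintro x ⟨i, hi⟩
    exact A.ball_mono hn (A.mem_ball_of_dist_le (hr i) hi)
  have hs' : ∀ i, s i ∈ B.ball a := by
    intro i
    rw [← hs i]
    exact h.mem_ball (hr i) (by omega)
  have hsub' : ∀ y ∈ (⟨B.toNetwork, s⟩ : RootedNetwork Ξ l).ball m, y ∈ B.ball n := by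
    rintro y ⟨i, hi⟩
    exact B.ball_mono hn (B.mem_ball_of_dist_le (hs' i) hi)
  refine ⟨hs, ?_, ?_, fun x hx => h.left_inv x (hsub x hx),
    fun y hy => h.right_inv y (hsub' y hy),
    fun x hx y hy => h.adj x (hsub x hx) y (hsub y hy), fun x hx => h.vertexCap x (hsub x hx),
    fun x hx y hy => h.pairCap x (hsub x hx) y (hsub y hy)⟩
  · rintro x ⟨i, hi⟩
    refine ⟨i, ?_⟩
    change B.graph.dist (s i) (φ x) ≤ m
    rw [← hs i]
    exact h.dist_le (hr i) hi hn
  · rintro y ⟨i, hi⟩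
    refine ⟨i, ?_⟩
    change A.graph.dist (r i) (ψ y) ≤ m
    rw [← h.left_inv (r i) (A.ball_mono (by omega) (hr i)), hs i]
    exact h.symm.dist_le (hs' i) hi hn

end BallMap

theorem Isom.exists_ballMap {A B : RootedNetwork Ξ k} (h : A.Isom B) (n : ℕ) :
    ∃ φ ψ, BallMap n A B φ ψ := by
  obtain ⟨φ, h1, h2, -, h4, -⟩ := h
  have hd : ∀ x y, B.graph.dist (φ x) (φ y) ≤ A.graph.dist x y := by
    intro x y
    obtain ⟨p, hp⟩ := A.connected.exists_walk_length_eq_dist x y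
    rw [← hp, ← SimpleGraph.Walk.length_map φ.toHom p]
    exact SimpleGraph.dist_le _
  have hd' : ∀ x y, A.graph.dist (φ.symm x) (φ.symm y) ≤ B.graph.dist x y := by
    intro x y
    obtain ⟨p, hp⟩ := B.connected.exists_walk_length_eq_dist x y
    rw [← hp, ← SimpleGraph.Walk.length_map φ.symm.toHom p]
    exact SimpleGraph.dist_le _
  refine ⟨φ, φ.symm, h1, ?_, ?_, fun x _ => φ.symm_apply_apply x, fun y _ => φ.apply_symm_apply y,
    fun x _ y _ => φ.map_adj_iff, fun x _ => h2 x, fun x _ y _ => ?_⟩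
  · rintro x ⟨i, hi⟩
    refine ⟨i, ?_⟩
    rw [← h1 i]
    exact (hd _ _).trans hi
  · rintro y ⟨i, hi⟩
    refine ⟨i, ?_⟩
    rw [← φ.symm_apply_apply (A.root i)]
    refine (hd' _ _).trans ?_
    rw [h1 i]
    exact hi
  · by_cases h : A.graph.Adj x y
    · rw [A.pairCap_of_adj h, B.pairCap_of_adj (φ.map_adj_iff.2 h)]
      exact h4 ⟨(x, y), h⟩
    · rw [A.pairCap_of_not_adj h, B.pairCap_of_not_adj (fun h' => h (φ.map_adj_iff.1 h'))]

theorem BallIsom.exists_ballMap [MetricSpace Ξ] {A B : RootedNetwork Ξ k} {d : ℝ≥0}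
    (h : A.BallIsom d B) : ∃ φ ψ, BallMap ⌊d⌋₊ A B φ ψ := by
  classical
  obtain ⟨φ, h1, h2, h3, -, h5⟩ := h
  obtain ⟨a⟩ := A.connected.nonempty
  obtain ⟨b⟩ := B.connected.nonempty
  set f : A.V → B.V := fun x => if hx : x ∈ A.ball ⌊d⌋₊ then φ ⟨x, hx⟩ else b with hf
  set g : B.V → A.V := fun y => if hy : y ∈ B.ball ⌊d⌋₊ then φ.symm ⟨y, hy⟩ else a with hg
  have ef : ∀ x (hx : x ∈ A.ball ⌊d⌋₊), f x = φ ⟨x, hx⟩ := fun x hx => dif_pos hx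
  have eg : ∀ y (hy : y ∈ B.ball ⌊d⌋₊), g y = φ.symm ⟨y, hy⟩ := fun y hy => dif_pos hy
  refine ⟨f, g, fun i => ?_, fun x hx => ?_, fun y hy => ?_, fun x hx => ?_, fun y hy => ?_,
    fun x hx y hy => ?_, fun x hx => ?_, fun x hx y hy => ?_⟩
  · rw [ef _ (A.root_mem_ball _ i), h1]
  · rw [ef x hx]
    exact (φ _).2
  · rw [eg y hy]
    exact (φ.symm _).2
  · rw [ef x hx, eg _ (φ _).2]
    simp
  · rw [eg y hy, ef _ (φ.symm _).2]
    simp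
  · rw [ef x hx, ef y hy]
    exact h2 ⟨x, hx⟩ ⟨y, hy⟩
  · rw [ef x hx]
    exact h3 ⟨x, hx⟩
  · rw [ef x hx, ef y hy]
    have hadj := h2 ⟨x, hx⟩ ⟨y, hy⟩
    by_cases h : A.graph.Adj x y
    · rw [A.pairCap_of_adj h, B.pairCap_of_adj (hadj.2 h)]
      exact (h5 ⟨x, hx⟩ ⟨y, hy⟩ h (hadj.2 h)).1
    · rw [A.pairCap_of_not_adj h, B.pairCap_of_not_adj (fun h' => h (hadj.1 h'))]

/-! ### Local functions -/

/-- A function of rooted networks is local if it is determined by the graph and the capacities in a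
ball of some fixed radius. -/
def IsLocal {α : Type*} (F : RootedNetwork Ξ k → α) : Prop :=
  ∃ R, ∀ n, R ≤ n → ∀ A B φ ψ, BallMap n A B φ ψ → F A = F B

theorem IsLocal.map₂ {α β γ : Type*} {F : RootedNetwork Ξ k → α} {G : RootedNetwork Ξ k → β}
    (hF : IsLocal F) (hG : IsLocal G) (f : α → β → γ) : IsLocal fun A => f (F A) (G A) := by
  obtain ⟨R, hR⟩ := hF
  obtain ⟨S, hS⟩ := hG
  refine ⟨max R S, fun n hn A B φ ψ h => ?_⟩
  dsimp only
  rw [hR n (by omega) A B φ ψ h, hS n (by omega) A B φ ψ h]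

theorem IsLocal.ite {α : Type*} {P : RootedNetwork Ξ k → Prop} (hP : IsLocal P)
    [∀ A, Decidable (P A)] {F : RootedNetwork Ξ k → α} (hF : IsLocal F) (a : α) :
    IsLocal fun A => if P A then F A else a := by
  obtain ⟨R, hR⟩ := hP
  obtain ⟨S, hS⟩ := hF
  refine ⟨max R S, fun n hn A B φ ψ h => ?_⟩
  exact if_congr (iff_of_eq (hR n (by omega) A B φ ψ h)) (hS n (by omega) A B φ ψ h) rfl

/-- A choice of new distinguished vertices among the old ones preserves locality. -/
theorem IsLocal.reroot {α : Type*} {F : RootedNetwork Ξ l → α} (hF : IsLocal F)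
    (σ : Fin l → Fin k) :
    IsLocal fun A : RootedNetwork Ξ k => F ⟨A.toNetwork, fun i => A.root (σ i)⟩ := by
  obtain ⟨R, hR⟩ := hF
  refine ⟨R, fun n hn A B φ ψ h => ?_⟩
  exact hR n hn _ _ φ ψ
    (h.reroot (a := 0) (fun i => A.root_mem_ball 0 _) (fun i => h.root _) (by omega))

theorem isLocal_dist_le (r : ℕ) (i j : Fin k) :
    IsLocal fun A : RootedNetwork Ξ k => A.graph.dist (A.root i) (A.root j) ≤ r := by
  refine ⟨r, fun n hn A B φ ψ h => propext ⟨fun hd => ?_, fun hd => ?_⟩⟩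
  · change B.graph.dist (B.root i) (B.root j) ≤ r
    rw [← h.root, ← h.root]
    exact h.dist_le (A.root_mem_ball 0 i) hd (by omega)
  · change A.graph.dist (A.root i) (A.root j) ≤ r
    rw [← h.symm.root, ← h.symm.root]
    exact h.symm.dist_le (B.root_mem_ball 0 i) hd (by omega)

theorem isLocal_pairCap (i j : Fin k) :
    IsLocal fun A : RootedNetwork Ξ k => A.pairCap (A.root i) (A.root j) := by
  refine ⟨0, fun n _ A B φ ψ h => ?_⟩
  dsimp only
  rw [← h.root, ← h.root, h.pairCap _ (A.root_mem_ball n i) _ (A.root_mem_ball n j)]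

theorem BallMap.weightIter_eq {n : ℕ} {A B : RootedNetwork Ξ k} {φ : A.V → B.V} {ψ : B.V → A.V}
    (h : BallMap n A B φ ψ) (lam : ℝ) (m : ℕ) {a : ℕ} {x y : A.V} (hx : x ∈ A.ball a)
    (hy : y ∈ A.ball n) (hn : a + m ≤ n) :
    B.weightIter lam m (φ x) (φ y) = A.weightIter lam m x y := by
  classical
  induction m generalizing a x y with
  | zero => rfl
  | succ m ih =>
    have hxn : x ∈ A.ball n := A.ball_mono (by omega) hx
    have hcav : B.cavity (B.weightIter lam m) (φ x) (φ y) =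
        A.cavity (A.weightIter lam m) x y := by
      unfold Network.cavity
      congr 1
      symm
      have hnb : ∀ t ∈ (A.nbrs x).erase y, t ∈ A.ball (a + 1) := fun t ht =>
        A.mem_ball_of_adj hx (A.mem_nbrs.1 (Finset.mem_of_mem_erase ht))
      have hnb' : ∀ t ∈ (B.nbrs (φ x)).erase (φ y), t ∈ B.ball n := fun t ht =>
        B.ball_mono (by omega) (B.mem_ball_of_adj (h.mem_ball hx (by omega))
          (B.mem_nbrs.1 (Finset.mem_of_mem_erase ht)))
      refine Finset.prod_nbij' φ ψ (fun t ht => ?_) (fun t ht => ?_) (fun t ht => ?_)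
        (fun t ht => ?_) (fun t ht => ?_)
      · have htn := A.ball_mono (by omega : a + 1 ≤ n) (hnb t ht)
        rw [Finset.mem_erase, Network.mem_nbrs] at ht ⊢
        refine ⟨fun hty => ht.1 ?_, (h.adj x hxn t htn).2 ht.2⟩
        rw [← h.left_inv t htn, hty, h.left_inv y hy]
      · have htn := hnb' t ht
        rw [Finset.mem_erase, Network.mem_nbrs] at ht ⊢
        refine ⟨fun hty => ht.1 ?_, ?_⟩
        · rw [← hty, h.right_inv t htn]
        · rw [← h.adj x hxn _ (h.mapsTo_symm t htn), h.right_inv t htn]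
          exact ht.2
      · exact h.left_inv t (A.ball_mono (by omega) (hnb t ht))
      · exact h.right_inv t (hnb' t ht)
      · rw [ih (hnb t ht) hxn (by omega)]
    funext z
    simp only [Network.weightIter, Network.weightUpdate]
    rw [hcav, h.vertexCap x hxn, h.pairCap x hxn y hy]

theorem isLocal_weightIter (lam : ℝ) (m : ℕ) (i j : Fin k) :
    IsLocal fun A : RootedNetwork Ξ k => A.weightIter lam m (A.root i) (A.root j) := by
  refine ⟨m, fun n hn A B φ ψ h => ?_⟩
  dsimp only
  rw [← h.root, ← h.root,
    h.weightIter_eq lam m (A.root_mem_ball 0 i) (A.root_mem_ball n j) (by omega)]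

/-- A sum of a local function of finite range over the position of the second distinguished vertex
is local. -/
theorem IsLocal.tsum {F : RootedNetwork Ξ 2 → ℝ≥0∞} (hF : IsLocal F) {r : ℕ}
    (hr : ∀ A : RootedNetwork Ξ 2, r < A.graph.dist (A.root 0) (A.root 1) → F A = 0) :
    IsLocal fun A : RootedNetwork Ξ 1 => ∑' v, F (A.birootAt (A.root 0) v) := by
  obtain ⟨R, hR⟩ := hF
  refine ⟨r + R, fun n hn A B φ ψ h => ?_⟩
  have hsupp : ∀ (C : RootedNetwork Ξ 1) v, F (C.birootAt (C.root 0) v) ≠ 0 →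
      C.graph.dist (C.root 0) v ≤ r := by
    intro C v hv
    by_contra hd
    exact hv (hr (C.birootAt (C.root 0) v) (by simpa [Network.birootAt] using hd))
  have hval : ∀ v, v ∈ A.ball r →
      F (A.birootAt (A.root 0) v) = F (B.birootAt (B.root 0) (φ v)) := by
    intro v hv
    refine hR R le_rfl _ _ φ ψ (h.reroot (a := r) ?_ ?_ (by omega))
    · intro i
      fin_cases i
      · exact A.root_mem_ball r 0
      · exact hv
    · intro i
      fin_cases i
      · exact h.root 0
      · rfl
  dsimp only
  symm
  refine tsum_eq_tsum_of_ne_zero_bij (fun v => φ v) ?_ ?_ ?_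
  · rintro ⟨v, hv⟩ ⟨w, hw⟩ hvw
    have hv' := A.ball_mono (by omega : r ≤ n) ⟨0, hsupp A v hv⟩
    have hw' := A.ball_mono (by omega : r ≤ n) ⟨0, hsupp A w hw⟩
    apply Subtype.ext
    change v = w
    rw [← h.left_inv v hv', ← h.left_inv w hw']
    exact congrArg ψ hvw
  · intro v hv
    have hv' : v ∈ B.ball r := ⟨0, hsupp B v hv⟩
    have hvn := B.ball_mono (by omega : r ≤ n) hv'
    have e := hval (ψ v) (h.symm.mem_ball hv' (by omega))
    rw [h.right_inv v hvn] at e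
    exact ⟨⟨ψ v, by rw [Function.mem_support, e]; exact hv⟩, h.right_inv v hvn⟩
  · rintro ⟨v, hv⟩
    exact (hval v ⟨0, hsupp A v hv⟩).symm

theorem finite_dist_le (A : Network Ξ) (x : A.V) (r : ℕ) : {v | A.graph.dist x v ≤ r}.Finite := by
  induction r with
  | zero =>
    refine (Set.finite_singleton x).subset fun v hv => ?_
    rw [Set.mem_ofPred_eq, Nat.le_zero, A.connected.dist_eq_zero_iff] at hv
    exact hv.symm
  | succ r ih =>
    refine (ih.union (ih.biUnion fun y _ => A.locallyFinite y)).subset fun v hv => ?_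
    rw [Set.mem_ofPred_eq] at hv
    rcases Nat.lt_or_ge r (A.graph.dist x v) with hlt | hle
    · right
      obtain ⟨p, hp⟩ := A.connected.exists_walk_length_eq_dist v x
      rw [SimpleGraph.dist_comm] at hp
      cases p with
      | nil =>
        rw [SimpleGraph.Walk.length_nil] at hp
        omega
      | cons hadj q =>
        rw [SimpleGraph.Walk.length_cons] at hp
        rw [Set.mem_iUnion₂]
        refine ⟨_, ?_, hadj.symm⟩
        rw [Set.mem_ofPred_eq, SimpleGraph.dist_comm]
        exact (SimpleGraph.dist_le q).trans (by omega)
    · exact Or.inl hle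

/-! ### Pointwise limits of local functions -/

/-- A pointwise limit of local functions. -/
def IsLocalLimit (F : RootedNetwork Ξ k → ℝ≥0∞) : Prop :=
  ∃ f : ℕ → RootedNetwork Ξ k → ℝ≥0∞, (∀ n, IsLocal (f n)) ∧
    ∀ A, Tendsto (fun n => f n A) atTop (𝓝 (F A))

theorem IsLocalLimit.eq_of_isom {F : RootedNetwork Ξ k → ℝ≥0∞} (hF : IsLocalLimit F)
    {A B : RootedNetwork Ξ k} (h : A.Isom B) : F A = F B := by
  obtain ⟨f, hf, hlim⟩ := hF
  refine tendsto_nhds_unique (hlim A) ?_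
  have : ∀ n, f n A = f n B := by
    intro n
    obtain ⟨R, hR⟩ := hf n
    obtain ⟨φ, ψ, hm⟩ := h.exists_ballMap R
    exact hR R le_rfl A B φ ψ hm
  simp only [this]
  exact hlim B

/-- A limit of local functions descends to isomorphism classes, where it is evaluated at a chosen
representative. -/
theorem IsLocalLimit.out_cls {F : RootedNetwork Ξ k → ℝ≥0∞} (hF : IsLocalLimit F)
    (A : RootedNetwork Ξ k) : F (Quotient.out A.cls) = F A :=
  hF.eq_of_isom (Quotient.mk_out A)

theorem IsLocalLimit.reroot {F : RootedNetwork Ξ l → ℝ≥0∞} (hF : IsLocalLimit F)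
    (σ : Fin l → Fin k) :
    IsLocalLimit fun A : RootedNetwork Ξ k => F ⟨A.toNetwork, fun i => A.root (σ i)⟩ := by
  obtain ⟨f, hf, hlim⟩ := hF
  exact ⟨fun n A => f n ⟨A.toNetwork, fun i => A.root (σ i)⟩, fun n => (hf n).reroot σ,
    fun A => hlim _⟩

theorem IsLocalLimit.sub {F G : RootedNetwork Ξ k → ℝ≥0∞} (hF : IsLocalLimit F)
    (hG : IsLocalLimit G) (h : ∀ A, G A ≠ ∞) : IsLocalLimit fun A => F A - G A := by
  obtain ⟨f, hf, hflim⟩ := hF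
  obtain ⟨g, hg, hglim⟩ := hG
  exact ⟨fun n A => f n A - g n A, fun n => (hf n).map₂ (hg n) (· - ·),
    fun A => ENNReal.Tendsto.sub (hflim A) (hglim A) (Or.inr (h A))⟩

theorem IsLocalLimit.ite_dist_le {F : RootedNetwork Ξ 2 → ℝ≥0∞} (hF : IsLocalLimit F) (r : ℕ) :
    IsLocalLimit fun A : RootedNetwork Ξ 2 =>
      if A.graph.dist (A.root 0) (A.root 1) ≤ r then F A else 0 := by
  obtain ⟨f, hf, hlim⟩ := hF
  refine ⟨fun n A => if A.graph.dist (A.root 0) (A.root 1) ≤ r then f n A else 0,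
    fun n => (isLocal_dist_le r 0 1).ite (hf n) 0, fun A => ?_⟩
  dsimp only
  split_ifs
  · exact hlim A
  · exact tendsto_const_nhds

theorem IsLocalLimit.tsum {F : RootedNetwork Ξ 2 → ℝ≥0∞} (hF : IsLocalLimit F) {r : ℕ}
    (hr : ∀ A : RootedNetwork Ξ 2, r < A.graph.dist (A.root 0) (A.root 1) → F A = 0) :
    IsLocalLimit fun A : RootedNetwork Ξ 1 => ∑' v, F (A.birootAt (A.root 0) v) := by
  classical
  obtain ⟨f, hf, hlim⟩ := hF
  -- the approximations are cut off outside the range of `F`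
  set f' : ℕ → RootedNetwork Ξ 2 → ℝ≥0∞ := fun n A =>
    if A.graph.dist (A.root 0) (A.root 1) ≤ r then f n A else 0 with hf'
  have hr' : ∀ n (A : RootedNetwork Ξ 2), r < A.graph.dist (A.root 0) (A.root 1) → f' n A = 0 :=
    fun n A hA => if_neg (not_le.2 hA)
  have hlim' : ∀ A, Tendsto (fun n => f' n A) atTop (𝓝 (F A)) := by
    intro A
    simp only [hf']
    split_ifs with h
    · exact hlim A
    · rw [hr A (not_le.1 h)]
      exact tendsto_const_nhds
  refine ⟨fun n A => ∑' v, f' n (A.birootAt (A.root 0) v), fun n => ?_, fun A => ?_⟩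
  · exact IsLocal.tsum ((isLocal_dist_le r 0 1).ite (hf n) 0) (hr' n)
  · set s := (finite_dist_le A.toNetwork (A.root 0) r).toFinset with hs
    have hout : ∀ G : RootedNetwork Ξ 2 → ℝ≥0∞,
        (∀ A : RootedNetwork Ξ 2, r < A.graph.dist (A.root 0) (A.root 1) → G A = 0) →
        ∑' v, G (A.birootAt (A.root 0) v) = ∑ v ∈ s, G (A.birootAt (A.root 0) v) := by
      intro G hG
      refine tsum_eq_sum fun v hv => hG _ ?_
      rw [hs, Set.Finite.mem_toFinset, Set.mem_ofPred_eq, not_le] at hv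
      exact hv
    dsimp only
    rw [hout F hr]
    simp only [hout _ (hr' _)]
    exact tendsto_finsetSum _ fun v _ => hlim' _

end RootedNetwork

/-! ### Measurability -/

namespace NetworkSpace

open RootedNetwork

variable {Ξ : Type u} [MetricSpace Ξ] {k : ℕ}

theorem exists_cls {Ξ : Type u} {k : ℕ} (g : NetworkSpace Ξ k) :
    ∃ A : RootedNetwork Ξ k, A.cls = g :=
  ⟨g.out, Quotient.out_eq g⟩

theorem localDist_self (g : NetworkSpace Ξ k) : localDist g g = 0 := by
  obtain ⟨A, rfl⟩ := exists_cls g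
  have hiso : ∀ d : ℝ≥0, A.BallIsom d A := by
    intro d
    refine ⟨Equiv.refl _, fun i => rfl, fun x y => Iff.rfl, fun x => rfl, fun x => ?_,
      fun x y h h' => ⟨rfl, ?_⟩⟩
    · change edist (A.vertexMark x) (A.vertexMark x) < _
      rw [edist_self]
      exact ENNReal.inv_pos.2 ENNReal.coe_ne_top
    · change edist (A.dartMark ⟨(x, y), h⟩) (A.dartMark ⟨(x, y), h⟩) < _
      rw [edist_self]
      exact ENNReal.inv_pos.2 ENNReal.coe_ne_top
  rw [localDist, ENNReal.inv_eq_zero, ENNReal.add_eq_top]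
  right
  refine ENNReal.eq_top_of_forall_nnreal_le fun d => ?_
  exact le_iSup₂_of_le d ⟨A, A, rfl, rfl, hiso _⟩ le_rfl

theorem exists_ballMap_of_localDist_lt {g h : NetworkSpace Ξ k} {R : ℕ}
    (hd : localDist g h < (1 + (R : ℝ≥0∞))⁻¹) :
    ∃ (A B : RootedNetwork Ξ k) (n : ℕ) (φ : A.V → B.V) (ψ : B.V → A.V),
      A.cls = g ∧ B.cls = h ∧ R ≤ n ∧ BallMap n A B φ ψ := by
  rw [localDist, ENNReal.inv_lt_inv, ENNReal.add_lt_add_iff_left ENNReal.one_ne_top] at hd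
  simp only [lt_iSup_iff] at hd
  obtain ⟨d, ⟨A, B, hA, hB, hiso⟩, hRd⟩ := hd
  obtain ⟨φ, ψ, hm⟩ := hiso.exists_ballMap
  refine ⟨A, B, ⌊d⌋₊, φ, ψ, hA, hB, Nat.le_floor ?_, hm⟩
  have : ((R : ℝ≥0) : ℝ≥0∞) < d := by simpa using hRd
  exact (ENNReal.coe_lt_coe.1 this).le

/-- A local function is locally constant in the local topology, hence measurable. -/
theorem measurable_of_isLocal {α : Type*} [MeasurableSpace α] {F : RootedNetwork Ξ k → α}
    (hF : IsLocal F) : Measurable fun g : NetworkSpace Ξ k => F g.out := by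
  obtain ⟨R, hR⟩ := hF
  have hinv : ∀ A B : RootedNetwork Ξ k, A.Isom B → F A = F B := by
    intro A B h
    obtain ⟨φ, ψ, hm⟩ := h.exists_ballMap R
    exact hR R le_rfl A B φ ψ hm
  have hout : ∀ A : RootedNetwork Ξ k, F (Quotient.out A.cls) = F A :=
    fun A => hinv _ _ (Quotient.mk_out A)
  intro S _
  apply IsOpen.measurableSet
  have : (fun g : NetworkSpace Ξ k => F g.out) ⁻¹' S =
      ⋃ g ∈ (fun g : NetworkSpace Ξ k => F g.out) ⁻¹' S,
        {h | localDist g h < (1 + (R : ℝ≥0∞))⁻¹} := by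
    ext h
    simp only [Set.mem_iUnion, Set.mem_ofPred_eq, exists_prop]
    constructor
    · intro hh
      refine ⟨h, hh, ?_⟩
      rw [localDist_self]
      exact ENNReal.inv_pos.2 (by finiteness)
    · rintro ⟨g, hg, hd⟩
      obtain ⟨A, B, n, φ, ψ, rfl, rfl, hn, hm⟩ := exists_ballMap_of_localDist_lt hd
      rw [Set.mem_preimage, hout] at hg ⊢
      rwa [← hR n hn A B φ ψ hm]
  rw [this]
  exact isOpen_biUnion fun g _ => TopologicalSpace.isOpen_generateFrom_of_mem ⟨g, _, rfl⟩

theorem measurable_of_isLocalLimit {F : RootedNetwork Ξ k → ℝ≥0∞} (hF : IsLocalLimit F) :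
    Measurable fun g : NetworkSpace Ξ k => F g.out := by
  obtain ⟨f, hf, hlim⟩ := hF
  refine measurable_of_tendsto_metrizable (fun n => measurable_of_isLocal (hf n)) ?_
  rw [tendsto_pi_nhds]
  exact fun g => hlim g.out

end NetworkSpace

/-! ### Consequences of the mass-transport principle -/

namespace RootedNetwork

open Filter Topology MeasureTheory NetworkSpace

variable {Ξ : Type u}

/-- The total of `F (G, v, u)` over all vertices `u`. -/
noncomputable def outFlow (F : RootedNetwork Ξ 2 → ℝ≥0∞) (N : Network Ξ) (v : N.V) : ℝ≥0∞ :=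
  ∑' u, F (N.birootAt v u)

/-- The total of `F (G, u, v)` over all vertices `u`. -/
noncomputable def inFlow (F : RootedNetwork Ξ 2 → ℝ≥0∞) (N : Network Ξ) (v : N.V) : ℝ≥0∞ :=
  ∑' u, F (N.birootAt u v)

theorem birootAt_comp_swap (N : Network Ξ) (u v : N.V) :
    (⟨N, fun i => (N.birootAt v u).root (![1, 0] i)⟩ : RootedNetwork Ξ 2) = N.birootAt u v := by
  simp only [Network.birootAt, mk.injEq, heq_eq_eq, true_and]
  funext i
  fin_cases i <;> rfl

theorem IsLocalLimit.outFlow {F : RootedNetwork Ξ 2 → ℝ≥0∞} (hF : IsLocalLimit F) {r : ℕ}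
    (hr : ∀ A : RootedNetwork Ξ 2, r < A.graph.dist (A.root 0) (A.root 1) → F A = 0) :
    IsLocalLimit fun A : RootedNetwork Ξ 1 => outFlow F A.toNetwork (A.root 0) :=
  hF.tsum hr

theorem IsLocalLimit.inFlow {F : RootedNetwork Ξ 2 → ℝ≥0∞} (hF : IsLocalLimit F) {r : ℕ}
    (hr : ∀ A : RootedNetwork Ξ 2, r < A.graph.dist (A.root 0) (A.root 1) → F A = 0) :
    IsLocalLimit fun A : RootedNetwork Ξ 1 => inFlow F A.toNetwork (A.root 0) := by
  have h := (hF.reroot (k := 2) ![1, 0]).tsum (r := r) (fun A hA => hr _ (by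
    rw [SimpleGraph.dist_comm] at hA
    exact hA))
  have e : ∀ A : RootedNetwork Ξ 1, RootedNetwork.inFlow F A.toNetwork (A.root 0) =
      ∑' v, F ⟨(A.birootAt (A.root 0) v).toNetwork,
        fun i => (A.birootAt (A.root 0) v).root (![1, 0] i)⟩ := by
    intro A
    refine tsum_congr fun v => ?_
    rw [← birootAt_comp_swap]
    rfl
  simp only [e]
  exact h

theorem massOut_cls {F : RootedNetwork Ξ 2 → ℝ≥0∞} (hF : IsLocalLimit F) (A : RootedNetwork Ξ 1) :
    massOut (fun g => F g.out) A.cls = outFlow F A.toNetwork (A.root 0) :=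
  tsum_congr fun v => hF.out_cls (A.birootAt (A.root 0) v)

theorem massIn_cls {F : RootedNetwork Ξ 2 → ℝ≥0∞} (hF : IsLocalLimit F) (A : RootedNetwork Ξ 1) :
    massIn (fun g => F g.out) A.cls = inFlow F A.toNetwork (A.root 0) :=
  tsum_congr fun v => hF.out_cls (A.birootAt v (A.root 0))

variable [MetricSpace Ξ] {ρ : Measure (NetworkSpace Ξ 1)}

/-- A nonnegative local quantity attached to the vertices which almost surely vanishes at the root
almost surely vanishes at every vertex: let every vertex `r` send the value at `v` to each `v`
within distance `n`. -/
theorem ae_forall_eq_zero (hρ : IsUnimodular ρ) {H : RootedNetwork Ξ 1 → ℝ≥0∞}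
    (hH : IsLocalLimit H) (h0 : ∀ᵐ g ∂ρ, H g.out = 0) :
    ∀ᵐ g ∂ρ, ∀ A : RootedNetwork Ξ 1, A.cls = g → ∀ v, H (A.rootAt v) = 0 := by
  have key : ∀ n : ℕ, ∀ᵐ g ∂ρ, ∀ A : RootedNetwork Ξ 1, A.cls = g → ∀ v,
      A.graph.dist (A.root 0) v ≤ n → H (A.rootAt v) = 0 := by
    intro n
    set F : RootedNetwork Ξ 2 → ℝ≥0∞ := fun A =>
      if A.graph.dist (A.root 0) (A.root 1) ≤ n then H (A.rootAt (A.root 1)) else 0 with hF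
    have hFl : IsLocalLimit F := (hH.reroot (k := 2) fun _ => 1).ite_dist_le n
    have hFr : ∀ A : RootedNetwork Ξ 2, n < A.graph.dist (A.root 0) (A.root 1) → F A = 0 :=
      fun A hA => if_neg (not_le.2 hA)
    have htransport := hρ (fun g => F g.out) (measurable_of_isLocalLimit hFl)
    have hin : ∀ᵐ g ∂ρ, massIn (fun g => F g.out) g = 0 := by
      filter_upwards [h0] with g
      obtain ⟨A, rfl⟩ := exists_cls g
      intro hA
      rw [hH.out_cls] at hA
      rw [massIn_cls hFl, inFlow, ENNReal.tsum_eq_zero]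
      intro u
      rw [← rootAt_root A] at hA
      change (if _ then H (A.rootAt (A.root 0)) else 0) = 0
      rw [hA, ite_self]
    rw [lintegral_congr_ae hin, lintegral_zero, lintegral_eq_zero_iff] at htransport
    · filter_upwards [htransport]
      rintro g hg A rfl v hv
      change massOut (fun g => F g.out) A.cls = 0 at hg
      rw [massOut_cls hFl, outFlow, ENNReal.tsum_eq_zero] at hg
      have := hg v
      change (if A.graph.dist (A.root 0) v ≤ n then H (A.rootAt v) else 0) = 0 at this
      rwa [if_pos hv] at this
    · have := measurable_of_isLocalLimit (hFl.outFlow hFr)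
      convert this using 1
      funext g
      obtain ⟨A, rfl⟩ := exists_cls g
      rw [massOut_cls hFl, (hFl.outFlow hFr).out_cls]
  rw [← ae_all_iff] at key
  filter_upwards [key]
  rintro g hg A hA v
  exact hg _ A hA v le_rfl

/-- If every vertex receives at least what it sends, and the amount sent is bounded by the capacity
of the sender, then almost surely no vertex receives more than it sends. -/
theorem ae_forall_inFlow_le_outFlow (hρ : IsUnimodular ρ)
    (hb : ∫⁻ g, (rootCap g : ℝ≥0∞) ∂ρ < ∞) {F : RootedNetwork Ξ 2 → ℝ≥0∞} (hF : IsLocalLimit F)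
    {r : ℕ} (hr : ∀ A : RootedNetwork Ξ 2, r < A.graph.dist (A.root 0) (A.root 1) → F A = 0)
    (hle : ∀ (N : Network Ξ) (v : N.V), outFlow F N v ≤ inFlow F N v)
    (hcap : ∀ (N : Network Ξ) (v : N.V), outFlow F N v ≤ N.vertexCap v) :
    ∀ᵐ g ∂ρ, ∀ A : RootedNetwork Ξ 1, A.cls = g → ∀ v,
      inFlow F A.toNetwork v ≤ outFlow F A.toNetwork v := by
  have hin := hF.inFlow hr
  have hout := hF.outFlow hr
  have hfin : ∀ A : RootedNetwork Ξ 1, outFlow F A.toNetwork (A.root 0) ≠ ∞ := fun A =>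
    ((hcap _ _).trans_lt (ENNReal.natCast_lt_top _)).ne
  have hroot : ∀ᵐ g ∂ρ, massOut (fun g => F g.out) g = massIn (fun g => F g.out) g := by
    refine ae_eq_of_ae_le_of_lintegral_le (Eventually.of_forall fun g => ?_) ?_ ?_ ?_
    · obtain ⟨A, rfl⟩ := exists_cls g
      rw [massOut_cls hF, massIn_cls hF]
      exact hle _ _
    · refine ((lintegral_mono fun g => ?_).trans_lt hb).ne
      obtain ⟨A, rfl⟩ := exists_cls g
      rw [massOut_cls hF]
      exact hcap _ _
    · have := measurable_of_isLocalLimit hin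
      refine Measurable.aemeasurable ?_
      convert this using 1
      funext g
      obtain ⟨A, rfl⟩ := exists_cls g
      rw [massIn_cls hF, hin.out_cls]
    · exact (hρ _ (measurable_of_isLocalLimit hF)).ge
  have hzero : ∀ᵐ g ∂ρ, (fun A : RootedNetwork Ξ 1 => inFlow F A.toNetwork (A.root 0) -
      outFlow F A.toNetwork (A.root 0)) g.out = 0 := by
    filter_upwards [hroot] with g
    obtain ⟨A, rfl⟩ := exists_cls g
    intro hA
    rw [massOut_cls hF, massIn_cls hF] at hA
    rw [(hin.sub hout hfin).out_cls, hA, tsub_self]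
  filter_upwards [ae_forall_eq_zero hρ (hin.sub hout hfin) hzero] with g hg A hA v
  exact tsub_eq_zero_iff_le.1 (hg A hA v)

end RootedNetwork

/-! ### Almost sure uniqueness of the fixed point -/

namespace Network

open Filter Topology RootedNetwork

variable {Ξ : Type u} {lam : ℝ}

/-- The load of the edge between the two distinguished vertices, computed from the low message into
the first one and the high message out of it. -/
noncomputable def lowHighLoad (lam : ℝ) (A : RootedNetwork Ξ 2) : ℝ≥0∞ :=
  ENNReal.ofReal (edgeLoad lam (A.pairCap (A.root 0) (A.root 1))
    (A.weightLow lam (A.root 1) (A.root 0)) (A.weightHigh lam (A.root 0) (A.root 1)))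

theorem isLocalLimit_lowHighLoad (hlam : 0 ≤ lam) :
    IsLocalLimit (lowHighLoad lam : RootedNetwork Ξ 2 → ℝ≥0∞) := by
  refine ⟨fun n A => ENNReal.ofReal (edgeLoad lam (A.pairCap (A.root 0) (A.root 1))
    (A.weightIter lam (2 * n) (A.root 1) (A.root 0))
    (A.weightIter lam (2 * n + 1) (A.root 0) (A.root 1))), fun n => ?_, fun A => ?_⟩
  · exact (isLocal_pairCap 0 1).map₂
      ((isLocal_weightIter lam (2 * n) 1 0).map₂ (isLocal_weightIter lam (2 * n + 1) 0 1)
        Prod.mk) (fun c pq => ENNReal.ofReal (edgeLoad lam c pq.1 pq.2))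
  · exact ENNReal.tendsto_ofReal (tendsto_edgeLoad hlam _ (isWeight_weightLow hlam _ _)
      (isWeight_weightHigh hlam _ _) (tendsto_weightLow hlam _ _) (tendsto_weightHigh hlam _ _))

theorem lowHighLoad_of_not_adj {A : RootedNetwork Ξ 2} (h : ¬ A.graph.Adj (A.root 0) (A.root 1)) :
    lowHighLoad lam A = 0 := by
  rw [lowHighLoad, A.pairCap_of_not_adj h, edgeLoad_zero, ENNReal.ofReal_zero]

theorem lowHighLoad_of_one_lt_dist (A : RootedNetwork Ξ 2)
    (h : 1 < A.graph.dist (A.root 0) (A.root 1)) : lowHighLoad lam A = 0 :=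
  lowHighLoad_of_not_adj fun hadj => by
    rw [SimpleGraph.dist_eq_one_iff_adj.2 hadj] at h
    exact lt_irrefl _ h

theorem outFlow_lowHighLoad (hlam : 0 ≤ lam) (N : Network Ξ) (v : N.V) :
    outFlow (lowHighLoad lam) N v = ENNReal.ofReal (N.vertexLoad (N.weightLow lam) v) := by
  rw [outFlow, tsum_eq_sum (s := N.nbrs v), ← vertexLoad_weightLow hlam,
    ENNReal.ofReal_sum_of_nonneg]
  · rfl
  · exact fun u _ => edgeLoad_nonneg hlam _ (isWeight_weightLow hlam _ _)
      (isWeight_weightHigh hlam _ _)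
  · exact fun u hu => lowHighLoad_of_not_adj fun h => hu (N.mem_nbrs.2 h)

theorem inFlow_lowHighLoad (hlam : 0 ≤ lam) (N : Network Ξ) (v : N.V) :
    inFlow (lowHighLoad lam) N v = ENNReal.ofReal (N.vertexLoad (N.weightHigh lam) v) := by
  rw [inFlow, tsum_eq_sum (s := N.nbrs v), ← vertexLoad_weightHigh hlam,
    ENNReal.ofReal_sum_of_nonneg]
  · rfl
  · exact fun u _ => edgeLoad_nonneg hlam _ (isWeight_weightLow hlam _ _)
      (isWeight_weightHigh hlam _ _)
  · exact fun u hu => lowHighLoad_of_not_adj fun h => hu (N.mem_nbrs.2 (SimpleGraph.Adj.symm h))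

end Network

open Network RootedNetwork in
/-- Almost surely the even and the odd iterates have the same limit. -/
theorem ae_weightLow_eq_weightHigh {Ξ : Type u} [MetricSpace Ξ]
    {ρ : MeasureTheory.Measure (NetworkSpace Ξ 1)} (hρ : IsUnimodular ρ)
    (hb : ∫⁻ g, (NetworkSpace.rootCap g : ℝ≥0∞) ∂ρ < ∞) {lam : ℝ} (hlam : 0 ≤ lam) :
    ∀ᵐ g ∂ρ, ∀ A : RootedNetwork Ξ 1, A.cls = g → A.weightLow lam = A.weightHigh lam := by
  have h := ae_forall_inFlow_le_outFlow hρ hb (isLocalLimit_lowHighLoad hlam)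
    lowHighLoad_of_one_lt_dist
    (fun N v => by
      rw [outFlow_lowHighLoad hlam, inFlow_lowHighLoad hlam]
      exact ENNReal.ofReal_le_ofReal (vertexLoad_le hlam v))
    (fun N v => by
      rw [outFlow_lowHighLoad hlam, ← ENNReal.ofReal_natCast]
      exact ENNReal.ofReal_le_ofReal (vertexLoad_le_vertexCap (isWeight_weightLow hlam) v))
  filter_upwards [h] with g hg A hA
  refine weightLow_eq_weightHigh hlam fun v => le_antisymm (vertexLoad_le hlam v) ?_
  have := hg A hA v
  rw [outFlow_lowHighLoad hlam, inFlow_lowHighLoad hlam] at this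
  refine (ENNReal.ofReal_le_ofReal_iff ?_).1 this
  rw [← vertexLoad_weightLow hlam]
  exact Finset.sum_nonneg fun u _ => edgeLoad_nonneg hlam _ (isWeight_weightLow hlam _ _)
    (isWeight_weightHigh hlam _ _)

theorem mainTheorem6 {Ξ : Type*} [MetricSpace Ξ] [CompleteSpace Ξ]
    [TopologicalSpace.SeparableSpace Ξ]
    (ρ : MeasureTheory.Measure (NetworkSpace Ξ 1)) [MeasureTheory.IsProbabilityMeasure ρ]
    (hρ : IsUnimodular ρ)
    (hb : ∫⁻ g, (NetworkSpace.rootCap g : ℝ≥0∞) ∂ρ < ∞)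
    (lam : ℝ) (hlam : 0 ≤ lam) :
    ∀ᵐ g ∂ρ, ∀ A : RootedNetwork Ξ 1, A.cls = g →
      ∃! m : A.graph.Dart → ℕ → ℝ, A.IsBPFixedPoint lam m := by
  filter_upwards [ae_weightLow_eq_weightHigh hρ hb hlam] with g hg A hA
  exact Network.existsUnique_isBPFixedPoint hlam (hg A hA)
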